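/- Consider the class of equations $$u_t=u_{xx}-c(t)u^3, \qquad (*)$$ where $u=u(t,x)$ is real and the arbitrary element $c$ is a smooth nonvanishing real function on an open interval. A point transformation is a diffeomorphism $\Phi\colon(t,x,u)\mapsto(\tilde t,\tilde x,\tilde u)$ of a connected open subset $\Omega$ of $\mathbb R^3$ onto its image. It is an admissible transformation from the equation with $c$ to the equation with $\tilde c$ if $\Omega$ and $\Phi(\Omega)$ lie over the domains of $c$ and $\tilde c$ respectively and the second prolongation of $\Phi$ maps the first equation to the second (as submanifolds of the second-order jet space). The triples $(c,\tilde c,\Phi)$ of this kind form the equivalence groupoid of the class. A (usual) equivalence transformation is a nondegenerate point transformation of the space of $(t,x,u,c)$, $c\neq0$, whose $(t,x,u)$-components do not depend on $c$, and which maps every equation of the class to an equation of the class, the new arbitrary element being given by its $c$-component. The class is normalized if every admissible transformation is induced by an element of the usual equivalence group, that is, of the set of equivalence transformations defined for all $(t,x,u)\in\mathbb R^3$ and all $c\neq 0$. Theorem. Class $(*)$ is normalized. Its usual equivalence group is indeed a group under composition and consists exactly of the transformations $$\tilde t=\delta_1^2t+\delta_0,\quad \tilde x=\delta_1x+\delta_2,\quad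 \tilde u=\delta_3u,\quad \tilde c(\tilde t)=\frac{1}{\delta_1^2\delta_3^2}\,c(t),$$ where $\delta_0,\delta_1,\delta_2,\delta_3$ are arbitrary real constants with $\delta_1\delta_3\neq0$; equivalence transformations that are defined only over a connected open subset of the space of $(t,x,u)$ have the same form there. The equivalence groupoid of the class is generated by these transformations: a map $\Phi$ on a connected open set $\Omega$, with $\Omega$ and $\Phi(\Omega)$ lying over the domains of $c$ and $\tilde c$, is an admissible transformation from the equation with $c$ to the equation with $\tilde c$ if and only if it is induced by an element of the group, i.e. if and only if, for some such constants, $\Phi(t,x,u)=(\delta_1^2t+\delta_0,\ \delta_1x+\delta_2,\ \delta_3u)$ and $\tilde c(\delta_1^2t+\delta_0)=c(t)/(\delta_1^2\delta_3^2)$ for all $(t,x,u)\in\Omega$. -/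

import Mathlib

open Set Filter Topology
open scoped ContDiff

namespace NWS

/-- The space of the variables `(t, x, u)`. -/
abbrev Pt : Type := ℝ × ℝ × ℝ

/-- The arbitrary element of the class `u_t = u_xx - c(t) u³`: a smooth nonvanishing real
function `c` on a nonempty open interval `dom` (its values outside `dom` are irrelevant). -/
structure Coeff where
  dom : Set ℝ
  isOpen_dom : IsOpen dom
  nonempty_dom : dom.Nonempty
  ordConnected_dom : dom.OrdConnected
  toFun : ℝ → ℝ
  smooth : ContDiffOn ℝ ∞ toFun dom
  ne_zero : ∀ t ∈ dom, toFun t ≠ 0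

/-- The function `f` satisfies `f_t = f_xx - c(t) f³` at the single point `(t, x)`, that is, the
2-jet of `f` at `(t, x)` lies on the submanifold of the second jet space that the equation
defines. -/
def SatisfiesAt (c : Coeff) (f : ℝ × ℝ → ℝ) (t x : ℝ) : Prop :=
  deriv (fun s => f (s, x)) t =
    deriv (fun z => deriv (fun y => f (t, y)) z) x - c.toFun t * f (t, x) ^ 3

/-- A nondegenerate point transformation `Φ` of a domain `Ω` of a space `E`: a smooth invertible
map with everywhere invertible derivative, that is, a diffeomorphism of `Ω` onto its image. -/
structure IsPointTransformation {E : Type*} [NormedAddCommGroup E] [NormedSpace ℝ E]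
    (Ω : Set E) (Φ : E → E) : Prop where
  isOpen : IsOpen Ω
  smooth : ContDiffOn ℝ ∞ Φ Ω
  injOn : InjOn Φ Ω
  nondegenerate : ∀ p ∈ Ω, (fderiv ℝ Φ p).IsInvertible

/-- Near the point `p₀ = (t₀, x₀)`, the transformation `Φ = (T, X, U)` maps the graph of `f` into
the graph of `g`:  `g (T (p, f p), X (p, f p)) = U (p, f p)` for all `p` close to `p₀`. -/
def MapsGraphNear (Φ : Pt → Pt) (f g : ℝ × ℝ → ℝ) (p₀ : ℝ × ℝ) : Prop :=
  ∀ᶠ p in 𝓝 p₀,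
    g ((Φ (p.1, p.2, f p)).1, (Φ (p.1, p.2, f p)).2.1) = (Φ (p.1, p.2, f p)).2.2

/-- Over `Ω`, the transformation `Φ` maps the equation with coefficient `c` to the equation with
coefficient `d`: the second prolongation of `Φ` takes the 2-jets (over `Ω`) that satisfy the first
equation to 2-jets that satisfy the second, and the jets that do not to jets that do not.
The prolongation is expressed through representatives: if `Φ` maps the graph of a smooth germ `f`
to the graph of a smooth germ `g`, then `Φ` takes the jet of `f` to the jet of `g`. -/
structure MapsEquation (c d : Coeff) (Ω : Set Pt) (Φ : Pt → Pt) : Prop where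
  source : ∀ p ∈ Ω, p.1 ∈ c.dom
  target : ∀ p ∈ Ω, (Φ p).1 ∈ d.dom
  jets : ∀ (f g : ℝ × ℝ → ℝ) (t x : ℝ),
    (t, x, f (t, x)) ∈ Ω →
    ContDiffAt ℝ ∞ f (t, x) →
    ContDiffAt ℝ ∞ g ((Φ (t, x, f (t, x))).1, (Φ (t, x, f (t, x))).2.1) →
    MapsGraphNear Φ f g (t, x) →
    (SatisfiesAt c f t x ↔
      SatisfiesAt d g (Φ (t, x, f (t, x))).1 (Φ (t, x, f (t, x))).2.1)

/-- `(c, d, Φ)` is an admissible transformation of the class (an element of its equivalence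
groupoid): `Φ` is a point transformation of a connected open set `Ω` of the space of `(t, x, u)`
that maps the equation with coefficient `c` to the equation with coefficient `d`. -/
structure IsAdmissible (c d : Coeff) (Ω : Set Pt) (Φ : Pt → Pt) : Prop where
  connected : IsConnected Ω
  pointTransformation : IsPointTransformation Ω Φ
  mapsEquation : MapsEquation c d Ω Φ

/-- `Ψ` is a (usual) equivalence transformation of the class over the connected open set `Ω` of
the space of `(t, x, u)`: a point transformation `(t, x, u, c) ↦ (T, X, U, C)`, for `(t, x, u)` in
`Ω` and nonzero values `c` of the arbitrary element, whose components `(T, X, U)` depend on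
`(t, x, u)` only and form a point transformation `Φ`, and such that, for every equation of the
class, `Φ` maps it to an equation of the class, the new arbitrary element being the one that `C`
prescribes. -/
def IsEquivalenceTransformation (Ω : Set Pt) (Ψ : Pt × ℝ → Pt × ℝ) : Prop :=
  IsConnected Ω ∧
  IsPointTransformation (Ω ×ˢ {k : ℝ | k ≠ 0}) Ψ ∧
  ∃ Φ : Pt → Pt, IsPointTransformation Ω Φ ∧
    (∀ p ∈ Ω, ∀ k : ℝ, k ≠ 0 → (Ψ (p, k)).1 = Φ p) ∧
    ∀ c : Coeff, ∃ d : Coeff,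
      MapsEquation c d (Ω ∩ {p | p.1 ∈ c.dom}) Φ ∧
      ∀ p ∈ Ω, p.1 ∈ c.dom → d.toFun (Φ p).1 = (Ψ (p, c.toFun p.1)).2

/-- The usual equivalence group of the class: the everywhere defined equivalence transformations,
as permutations of the space of `(t, x, u, c)` with `c ≠ 0`. -/
def equivalenceGroup : Set (Equiv.Perm (Pt × ℝˣ)) :=
  {σ | ∃ Ψ : Pt × ℝ → Pt × ℝ, IsEquivalenceTransformation univ Ψ ∧
    ∀ (p : Pt) (k : ℝˣ), Ψ (p, (k : ℝ)) = ((σ (p, k)).1, ((σ (p, k)).2 : ℝ))}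

/-- `(c, d, Φ)`, over `Ω`, is induced by the transformation `σ` of the space of `(t, x, u, c)`:
on `Ω`, `Φ` is the `(t, x, u)`-part of `σ`, and `σ` takes the value of `c` at a point to
the value of `d` at the image point. -/
def IsInducedBy (σ : Equiv.Perm (Pt × ℝˣ)) (c d : Coeff) (Ω : Set Pt) (Φ : Pt → Pt) : Prop :=
  ∀ p ∈ Ω, ∀ k : ℝˣ, (k : ℝ) = c.toFun p.1 →
    (σ (p, k)).1 = Φ p ∧ ((σ (p, k)).2 : ℝ) = d.toFun (Φ p).1

/-- The class is normalized (in the usual sense): every admissible transformation is induced by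
an element of the usual equivalence group. -/
def IsNormalized : Prop :=
  ∀ (c d : Coeff) (Ω : Set Pt) (Φ : Pt → Pt), IsAdmissible c d Ω Φ →
    ∃ σ ∈ equivalenceGroup, IsInducedBy σ c d Ω Φ

/-- The transformation `t ↦ δ₁² t + δ₀`, `x ↦ δ₁ x + δ₂`, `u ↦ δ₃ u`. -/
noncomputable def scaling (δ₀ δ₁ δ₂ δ₃ : ℝ) (p : Pt) : Pt :=
  (δ₁ ^ 2 * p.1 + δ₀, δ₁ * p.2.1 + δ₂, δ₃ * p.2.2)

end NWS

namespace NWS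

/-! ### Affine transformations -/

/-! That the scalings act as claimed is the chain rule (`mapsEquation_of_eqOn_scaling`). The
substance is the converse, Lie's direct method.

On jets solving the source equation, `u_t = a`, `u_x = b` and `u_tt = q` remain free. Let `g` be the
function whose graph is the image of the graph of `u`. The target equation fixes the second
`X`-derivative of `g`, and differentiating `g(T, X) = U` twice along a curve in the graph of `u`
whose tangent is killed by `dT` isolates that derivative. The result, `MapsEquation.prolongation`,
is an identity in `a`, `b`, `q`, which is then split. The dependence on `q` forces `T_x = T_u = 0`
(`pd_time_eq_zero`); the dependence on `a` then gives `X_u = 0` and `X_x² = T_t` (`pd_space_eq`);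
and the powers of `b` leave three determining equations (`determining_equations`). The nonvanishing
Jacobian enters at the first two stages.

In the last determining equation `U` is affine in `u`, so three `u`-derivatives isolate the cubic
terms: `T_t d(T) U_u² = c(t)`. With `c` and `d` nonvanishing, this makes `U` homogeneous in `u` and
kills every remaining nonconstant coefficient (`affine_of_isAdmissible`). Connectedness of `Ω`
integrates the result to a scaling.

An equivalence transformation is handled by applying this to constant coefficients: the same `Φ`
serves all of them, so the factors `δ₁`, `δ₃` are common. -/

theorem IsPointTransformation.of_eqOn_affine {E : Type*} [NormedAddCommGroup E] [NormedSpace ℝ E]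
    {Ω : Set E} {Φ : E → E} (hΩ : IsOpen Ω) (L : E ≃L[ℝ] E) (v : E)
    (h : ∀ p ∈ Ω, Φ p = L p + v) : IsPointTransformation Ω Φ where
  isOpen := hΩ
  smooth := (L.contDiff.add contDiff_const).contDiffOn.congr h
  injOn p hp q hq hpq := by
    rw [h p hp, h q hq] at hpq
    exact L.injective (add_right_cancel hpq)
  nondegenerate p hp := by
    have h1 : HasFDerivAt Φ (L : E →L[ℝ] E) p :=
      (L.hasFDerivAt.add_const v).congr_of_eventuallyEq
        (by filter_upwards [hΩ.mem_nhds hp] with q hq using h q hq)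
    rw [h1.fderiv]
    exact ⟨L, rfl⟩

/-- The linear automorphism `(t, x, u) ↦ (α t, β x, γ u)`. -/
noncomputable def diagEquiv (α β γ : ℝˣ) : Pt ≃L[ℝ] Pt :=
  (ContinuousLinearEquiv.unitsEquivAut ℝ α).prodCongr
    ((ContinuousLinearEquiv.unitsEquivAut ℝ β).prodCongr (ContinuousLinearEquiv.unitsEquivAut ℝ γ))

theorem diagEquiv_apply (α β γ : ℝˣ) (p : Pt) :
    diagEquiv α β γ p = (p.1 * α, p.2.1 * β, p.2.2 * γ) := rfl

theorem isPointTransformation_of_eqOn_scaling {Ω : Set Pt} {Φ : Pt → Pt} (hΩ : IsOpen Ω)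
    {δ₀ δ₁ δ₂ δ₃ : ℝ} (hδ : δ₁ * δ₃ ≠ 0) (h : ∀ p ∈ Ω, Φ p = scaling δ₀ δ₁ δ₂ δ₃ p) :
    IsPointTransformation Ω Φ := by
  have h1 : δ₁ ≠ 0 := left_ne_zero_of_mul hδ
  have h3 : δ₃ ≠ 0 := right_ne_zero_of_mul hδ
  refine .of_eqOn_affine hΩ (diagEquiv (Units.mk0 (δ₁ ^ 2) (pow_ne_zero 2 h1)) (Units.mk0 δ₁ h1)
    (Units.mk0 δ₃ h3)) (δ₀, δ₂, 0) fun p hp => ?_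
  rw [h p hp]
  simp [diagEquiv_apply, scaling, mul_comm]

theorem isPointTransformation_of_eqOn_scaling_prod {Ω : Set Pt} {Ψ : Pt × ℝ → Pt × ℝ}
    (hΩ : IsOpen Ω) {δ₀ δ₁ δ₂ δ₃ : ℝ} (hδ : δ₁ * δ₃ ≠ 0)
    (h : ∀ p ∈ Ω, ∀ k : ℝ, k ≠ 0 →
      Ψ (p, k) = (scaling δ₀ δ₁ δ₂ δ₃ p, 1 / (δ₁ ^ 2 * δ₃ ^ 2) * k)) :
    IsPointTransformation (Ω ×ˢ {k : ℝ | k ≠ 0}) Ψ := by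
  have h1 : δ₁ ≠ 0 := left_ne_zero_of_mul hδ
  have h3 : δ₃ ≠ 0 := right_ne_zero_of_mul hδ
  have h4 : 1 / (δ₁ ^ 2 * δ₃ ^ 2) ≠ 0 := by positivity
  refine .of_eqOn_affine (hΩ.prod isOpen_ne)
    ((diagEquiv (Units.mk0 (δ₁ ^ 2) (pow_ne_zero 2 h1)) (Units.mk0 δ₁ h1) (Units.mk0 δ₃ h3)).prodCongr
      (ContinuousLinearEquiv.unitsEquivAut ℝ (Units.mk0 _ h4))) ((δ₀, δ₂, 0), 0) ?_
  rintro ⟨p, k⟩ ⟨hp, hk⟩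
  rw [h p hp k hk]
  simp [diagEquiv_apply, scaling, mul_comm]

theorem mapsEquation_of_eqOn_scaling {c d : Coeff} {Ω : Set Pt} {Φ : Pt → Pt} (hΩ : IsOpen Ω)
    (hc : ∀ p ∈ Ω, p.1 ∈ c.dom) (hd : ∀ p ∈ Ω, (Φ p).1 ∈ d.dom)
    {δ₀ δ₁ δ₂ δ₃ : ℝ} (hδ : δ₁ * δ₃ ≠ 0) (h : ∀ p ∈ Ω, Φ p = scaling δ₀ δ₁ δ₂ δ₃ p)
    (hcd : ∀ p ∈ Ω, d.toFun (δ₁ ^ 2 * p.1 + δ₀) = 1 / (δ₁ ^ 2 * δ₃ ^ 2) * c.toFun p.1) :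
    MapsEquation c d Ω Φ where
  source := hc
  target := hd
  jets f g t x hp hf _ hfg := by
    have h1 : δ₁ ≠ 0 := left_ne_zero_of_mul hδ
    have h3 : δ₃ ≠ 0 := right_ne_zero_of_mul hδ
    have hev : ∀ᶠ z : ℝ × ℝ in 𝓝 (t, x),
        g (δ₁ ^ 2 * z.1 + δ₀, δ₁ * z.2 + δ₂) = δ₃ * f z := by
      have hmem : ∀ᶠ z : ℝ × ℝ in 𝓝 (t, x), (z.1, z.2, f z) ∈ Ω := by
        have : ContinuousAt (fun z : ℝ × ℝ => (z.1, z.2, f z)) (t, x) :=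
          continuousAt_fst.prodMk (continuousAt_snd.prodMk hf.continuousAt)
        exact this.eventually_mem (hΩ.mem_nhds hp)
      filter_upwards [hmem, hfg] with z hz hz'
      rw [h _ hz] at hz'
      exact hz'
    have hcd' := hcd _ hp
    have hval := hev.self_of_nhds
    rw [h _ hp]
    simp only [SatisfiesAt, scaling] at hcd' hval ⊢
    -- `deriv` commutes with affine substitutions and constant factors without any differentiability
    -- assumption.
    have hT : δ₁ ^ 2 * deriv (fun s => g (s, δ₁ * x + δ₂)) (δ₁ ^ 2 * t + δ₀)
        = δ₃ * deriv (fun s => f (s, x)) t := by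
      have hl : Tendsto (fun s : ℝ => (s, x)) (𝓝 t) (𝓝 (t, x)) :=
        (Continuous.prodMk_left x).tendsto t
      have hl2 := hl.eventually hev
      have := EventuallyEq.deriv_eq hl2
      rw [deriv_const_mul_field] at this
      rw [← this]
      have e1 := deriv_comp_mul_left (δ₁ ^ 2) (fun s => g (s + δ₀, δ₁ * x + δ₂)) t
      have e2 := deriv_comp_add_const (fun s => g (s, δ₁ * x + δ₂)) δ₀ (δ₁ ^ 2 * t)
      simp only [smul_eq_mul] at e1 e2
      rw [e1, e2]
    -- Stated on a neighbourhood of `x`, because it is differentiated once more.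
    have hX : ∀ᶠ y in 𝓝 x, δ₁ * deriv (fun s => g (δ₁ ^ 2 * t + δ₀, s)) (δ₁ * y + δ₂)
        = δ₃ * deriv (fun s => f (t, s)) y := by
      have hl : Tendsto (fun s : ℝ => (t, s)) (𝓝 x) (𝓝 (t, x)) :=
        (Continuous.prodMk_right t).tendsto x
      filter_upwards [(hl.eventually hev).eventually_nhds] with y hy
      have := EventuallyEq.deriv_eq hy
      rw [deriv_const_mul_field] at this
      rw [← this]
      have e1 := deriv_comp_mul_left δ₁ (fun s => g (δ₁ ^ 2 * t + δ₀, s + δ₂)) y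
      have e2 := deriv_comp_add_const (fun s => g (δ₁ ^ 2 * t + δ₀, s)) δ₂ (δ₁ * y)
      simp only [smul_eq_mul] at e1 e2
      rw [e1, e2]
    have hXX : δ₁ ^ 2 * deriv (fun z => deriv (fun s => g (δ₁ ^ 2 * t + δ₀, s)) z) (δ₁ * x + δ₂)
        = δ₃ * deriv (fun z => deriv (fun s => f (t, s)) z) x := by
      have := EventuallyEq.deriv_eq hX
      rw [deriv_const_mul_field, deriv_const_mul_field] at this
      rw [← this]
      have e1 := deriv_comp_mul_left δ₁ (fun y => deriv (fun s => g (δ₁ ^ 2 * t + δ₀, s)) (y + δ₂)) x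
      have e2 := deriv_comp_add_const
        (fun y => deriv (fun s => g (δ₁ ^ 2 * t + δ₀, s)) y) δ₂ (δ₁ * x)
      simp only [smul_eq_mul] at e1 e2
      rw [e1, e2]
      ring
    rw [hcd', hval]
    have hk : δ₁ ^ 2 * δ₃ ^ 2 * (1 / (δ₁ ^ 2 * δ₃ ^ 2)) = 1 := by field_simp
    constructor
    · intro H
      apply mul_left_cancel₀ (pow_ne_zero 2 h1)
      rw [hT, H]
      linear_combination -hXX + δ₃ * c.toFun t * f (t, x) ^ 3 * hk
    · intro H
      apply mul_left_cancel₀ h3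
      rw [← hT, H]
      linear_combination hXX - δ₃ * c.toFun t * f (t, x) ^ 3 * hk

/-- The equation that the scaling makes of the equation with coefficient `c`. -/
noncomputable def Coeff.scale (c : Coeff) (δ₀ : ℝ) {δ₁ δ₃ : ℝ} (hδ : δ₁ * δ₃ ≠ 0) : Coeff where
  -- The image of the interval, written as a preimage under the inverse so that openness and
  -- order-connectedness pull back.
  dom := {s | (s - δ₀) / δ₁ ^ 2 ∈ c.dom}
  isOpen_dom := c.isOpen_dom.preimage (by fun_prop)
  nonempty_dom := by
    obtain ⟨t, ht⟩ := c.nonempty_dom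
    have h1 : δ₁ ≠ 0 := left_ne_zero_of_mul hδ
    refine ⟨δ₁ ^ 2 * t + δ₀, ?_⟩
    have : (δ₁ ^ 2 * t + δ₀ - δ₀) / δ₁ ^ 2 = t := by field_simp; ring
    rwa [mem_ofPred_eq, this]
  ordConnected_dom := by
    have hm : Monotone fun s : ℝ => (s - δ₀) / δ₁ ^ 2 := fun a b hab => by
      dsimp only
      gcongr
    exact c.ordConnected_dom.preimage_mono hm
  toFun s := 1 / (δ₁ ^ 2 * δ₃ ^ 2) * c.toFun ((s - δ₀) / δ₁ ^ 2)
  smooth := by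
    refine contDiffOn_const.mul (c.smooth.comp ?_ fun s hs => hs)
    fun_prop
  ne_zero s hs := by
    have h1 : δ₁ ≠ 0 := left_ne_zero_of_mul hδ
    have h3 : δ₃ ≠ 0 := right_ne_zero_of_mul hδ
    exact mul_ne_zero (by positivity) (c.ne_zero _ hs)

theorem isEquivalenceTransformation_of_scaling {Ω : Set Pt} {Ψ : Pt × ℝ → Pt × ℝ}
    (hΩ : IsOpen Ω) (hconn : IsConnected Ω) {δ₀ δ₁ δ₂ δ₃ : ℝ} (hδ : δ₁ * δ₃ ≠ 0)
    (h : ∀ p ∈ Ω, ∀ k : ℝ, k ≠ 0 →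
      Ψ (p, k) = (scaling δ₀ δ₁ δ₂ δ₃ p, 1 / (δ₁ ^ 2 * δ₃ ^ 2) * k)) :
    IsEquivalenceTransformation Ω Ψ := by
  have h1 : δ₁ ≠ 0 := left_ne_zero_of_mul hδ
  refine ⟨hconn, isPointTransformation_of_eqOn_scaling_prod hΩ hδ h, scaling δ₀ δ₁ δ₂ δ₃,
    isPointTransformation_of_eqOn_scaling hΩ hδ fun _ _ => rfl,
    fun p hp k hk => by rw [h p hp k hk], fun c => ⟨c.scale δ₀ hδ, ?_, ?_⟩⟩
  · have key : ∀ t : ℝ, (δ₁ ^ 2 * t + δ₀ - δ₀) / δ₁ ^ 2 = t := fun t => by field_simp; ring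
    refine mapsEquation_of_eqOn_scaling (hΩ.inter (c.isOpen_dom.preimage continuous_fst))
      (fun p hp => hp.2) (fun p hp => ?_) hδ (fun _ _ => rfl) fun p hp => ?_
    · simp only [Coeff.scale, scaling, mem_ofPred_eq, key]
      exact hp.2
    · simp only [Coeff.scale, key]
  · intro p hp hpc
    have key : ∀ t : ℝ, (δ₁ ^ 2 * t + δ₀ - δ₀) / δ₁ ^ 2 = t := fun t => by field_simp; ring
    rw [h p hp _ (c.ne_zero _ hpc)]
    simp only [Coeff.scale, scaling, key]

/-- The scaling, with its action on the arbitrary element, as a permutation. -/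
noncomputable def scalingPerm (δ₀ δ₂ : ℝ) (δ₁ δ₃ : ℝˣ) : Equiv.Perm (Pt × ℝˣ) where
  toFun q := (scaling δ₀ δ₁ δ₂ δ₃ q.1, (δ₁ ^ 2 * δ₃ ^ 2)⁻¹ * q.2)
  invFun q := (((q.1.1 - δ₀) / δ₁ ^ 2, (q.1.2.1 - δ₂) / δ₁, q.1.2.2 / δ₃), δ₁ ^ 2 * δ₃ ^ 2 * q.2)
  left_inv := by
    rintro ⟨⟨t, x, u⟩, k⟩
    simp [scaling, -mul_inv_rev]
  right_inv := by
    rintro ⟨⟨t, x, u⟩, k⟩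
    simp [scaling, mul_div_cancel₀, -mul_inv_rev]

/-- `σ` acts on the space of `(t, x, u, c)` by the scaling with the given constants. -/
def IsScaling (σ : Equiv.Perm (Pt × ℝˣ)) (δ₀ δ₁ δ₂ δ₃ : ℝ) : Prop :=
  δ₁ * δ₃ ≠ 0 ∧ ∀ (p : Pt) (k : ℝˣ), (σ (p, k)).1 = scaling δ₀ δ₁ δ₂ δ₃ p ∧
    ((σ (p, k)).2 : ℝ) = 1 / (δ₁ ^ 2 * δ₃ ^ 2) * (k : ℝ)

theorem exists_isScaling (δ₀ : ℝ) {δ₁ : ℝ} (δ₂ : ℝ) {δ₃ : ℝ} (hδ : δ₁ * δ₃ ≠ 0) :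
    ∃ σ, IsScaling σ δ₀ δ₁ δ₂ δ₃ := by
  have h1 : δ₁ ≠ 0 := left_ne_zero_of_mul hδ
  have h3 : δ₃ ≠ 0 := right_ne_zero_of_mul hδ
  refine ⟨scalingPerm δ₀ δ₂ (Units.mk0 δ₁ h1) (Units.mk0 δ₃ h3), hδ, fun p k => ⟨rfl, ?_⟩⟩
  simp [scalingPerm]

theorem IsScaling.mem_equivalenceGroup {σ : Equiv.Perm (Pt × ℝˣ)} {δ₀ δ₁ δ₂ δ₃ : ℝ}
    (h : IsScaling σ δ₀ δ₁ δ₂ δ₃) : σ ∈ equivalenceGroup := by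
  refine ⟨fun q => (scaling δ₀ δ₁ δ₂ δ₃ q.1, 1 / (δ₁ ^ 2 * δ₃ ^ 2) * q.2),
    isEquivalenceTransformation_of_scaling isOpen_univ isConnected_univ h.1 fun _ _ _ _ => rfl,
    fun p k => ?_⟩
  rw [(h.2 p k).1, (h.2 p k).2]

theorem IsScaling.one : IsScaling 1 0 1 0 1 :=
  ⟨by norm_num, fun p k => by simp [scaling]⟩

theorem IsScaling.mul {σ τ : Equiv.Perm (Pt × ℝˣ)} {δ₀ δ₁ δ₂ δ₃ ε₀ ε₁ ε₂ ε₃ : ℝ}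
    (h : IsScaling σ δ₀ δ₁ δ₂ δ₃) (h' : IsScaling τ ε₀ ε₁ ε₂ ε₃) :
    IsScaling (σ * τ) (δ₁ ^ 2 * ε₀ + δ₀) (δ₁ * ε₁) (δ₁ * ε₂ + δ₂) (δ₃ * ε₃) := by
  have h1 := h.1
  have h2 := h'.1
  refine ⟨by rw [mul_mul_mul_comm]; exact mul_ne_zero h1 h2, fun p k => ?_⟩
  have e1 := h'.2 p k
  have e2 := h.2 (τ (p, k)).1 (τ (p, k)).2
  rw [Equiv.Perm.mul_apply]
  refine ⟨?_, ?_⟩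
  · rw [e2.1, e1.1]
    simp only [scaling, Prod.mk.injEq]
    refine ⟨?_, ?_, ?_⟩ <;> ring
  · rw [e2.2, e1.2, mul_pow, mul_pow, ← mul_assoc, one_div_mul_one_div]
    congr 2
    ring

theorem IsScaling.inv {σ : Equiv.Perm (Pt × ℝˣ)} {δ₀ δ₁ δ₂ δ₃ : ℝ}
    (h : IsScaling σ δ₀ δ₁ δ₂ δ₃) :
    IsScaling σ⁻¹ (-(δ₁⁻¹ ^ 2 * δ₀)) δ₁⁻¹ (-(δ₁⁻¹ * δ₂)) δ₃⁻¹ := by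
  have h1 : δ₁ ≠ 0 := left_ne_zero_of_mul h.1
  have h3 : δ₃ ≠ 0 := right_ne_zero_of_mul h.1
  refine ⟨mul_ne_zero (inv_ne_zero h1) (inv_ne_zero h3), fun p k => ?_⟩
  -- With the argument written as an image under `σ`, the inverse is evaluated without an explicit
  -- formula for it.
  obtain ⟨⟨q, l⟩, hq⟩ := σ.surjective (p, k)
  have e := h.2 q l
  rw [hq] at e
  have e0 : σ⁻¹ (p, k) = (q, l) := by rw [← hq]; exact σ.symm_apply_apply _
  rw [e0]
  have e1 : p = _ := e.1
  have e2 : (k : ℝ) = _ := e.2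
  rw [e1, e2]
  obtain ⟨t, x, u⟩ := q
  simp only [scaling, Prod.mk.injEq]
  refine ⟨⟨?_, ?_, ?_⟩, ?_⟩ <;> field_simp <;> ring

/-! ### The second prolongation -/

/-- The coordinate vector of `t`. -/
def eT : Pt := (1, 0, 0)

/-- The coordinate vector of `x`. -/
def eX : Pt := (0, 1, 0)

/-- The coordinate vector of `u`. -/
def eU : Pt := (0, 0, 1)

theorem eq_smul_add_smul (v : Pt) : v = v.1 • eT + v.2.1 • eX + v.2.2 • eU := by
  simp [eT, eX, eU]

/-- The derivative of `F` in the direction of `v`. -/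
noncomputable def pd (v : Pt) (F : Pt → ℝ) (p : Pt) : ℝ := fderiv ℝ F p v

theorem fderiv_apply_eq_pd (F : Pt → ℝ) (p v : Pt) :
    fderiv ℝ F p v = v.1 * pd eT F p + v.2.1 * pd eX F p + v.2.2 * pd eU F p := by
  conv_lhs => rw [eq_smul_add_smul v]
  simp only [map_add, map_smul, smul_eq_mul, pd]

/-! ### Second derivatives along curves -/

section Curves

variable {E : Type*} [NormedAddCommGroup E] [NormedSpace ℝ E]

/-- The chain rule applied twice: `(F ∘ γ)'' = D²F(γ', γ') + DF(γ'')`. The first derivative is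
needed near `0` in order to be differentiated again. -/
theorem eventually_hasDerivAt_comp_curve {F : E → ℝ} {γ γ' : ℝ → E} {γ'' : E}
    (hF : ContDiffAt ℝ 2 F (γ 0)) (hγ : ∀ᶠ s in 𝓝 0, HasDerivAt γ (γ' s) s)
    (hγ' : HasDerivAt γ' γ'' 0) :
    (∀ᶠ s in 𝓝 0, HasDerivAt (fun s => F (γ s)) (fderiv ℝ F (γ s) (γ' s)) s) ∧
      HasDerivAt (fun s => fderiv ℝ F (γ s) (γ' s))
        (fderiv ℝ (fderiv ℝ F) (γ 0) (γ' 0) (γ' 0) + fderiv ℝ F (γ 0) γ'') 0 := by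
  have h0 := hγ.self_of_nhds
  constructor
  · have h1 : ∀ᶠ z in 𝓝 (γ 0), DifferentiableAt ℝ F z := by
      filter_upwards [hF.eventually (by simp)] with z hz using hz.differentiableAt (by simp)
    filter_upwards [hγ, h0.continuousAt.eventually h1] with s hs hs'
    exact hs'.hasFDerivAt.comp_hasDerivAt s hs
  · have h2 : HasFDerivAt (fderiv ℝ F) (fderiv ℝ (fderiv ℝ F) (γ 0)) (γ 0) :=
      ((hF.fderiv_right (m := 1) (by norm_num)).differentiableAt (by simp)).hasFDerivAt
    exact (h2.comp_hasDerivAt (0 : ℝ) h0).clm_apply hγ'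

theorem snd_deriv_unique {F G F' G' : ℝ → ℝ} {a b : ℝ} (h : F =ᶠ[𝓝 0] G)
    (hF : ∀ᶠ s in 𝓝 0, HasDerivAt F (F' s) s) (hF' : HasDerivAt F' a 0)
    (hG : ∀ᶠ s in 𝓝 0, HasDerivAt G (G' s) s) (hG' : HasDerivAt G' b 0) : a = b := by
  have : F' =ᶠ[𝓝 0] G' := by
    filter_upwards [h.eventually_nhds, hF, hG] with s hs h1 h2
    exact (h1.congr_of_eventuallyEq (EventuallyEq.symm hs)).unique h2
  exact (hF'.congr_of_eventuallyEq this.symm).unique hG'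

end Curves

theorem hasDerivAt_parabola (p w : Pt) (κ s : ℝ) :
    HasDerivAt (fun s : ℝ => p + s • w + (s ^ 2 / 2 * κ) • eU) (w + (s * κ) • eU) s := by
  have h1 : HasDerivAt (fun s : ℝ => s ^ 2 / 2 * κ) (s * κ) s := by
    refine (((hasDerivAt_pow 2 s).div_const 2).mul_const κ).congr_deriv ?_
    push_cast
    ring
  have := (((hasDerivAt_id s).smul_const w).const_add p).add (h1.smul_const eU)
  rw [one_smul] at this
  exact this

theorem hasDerivAt_parabola' (w : Pt) (κ s : ℝ) :
    HasDerivAt (fun s : ℝ => w + (s * κ) • eU) (κ • eU) s := by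
  have := (((hasDerivAt_id s).mul_const κ).smul_const eU).const_add w
  rw [one_mul] at this
  exact this

/-- The chain rule of second order for `g ∘ (T, X) = U` along a parabola with a tangent vector
that `dT` annihilates. -/
theorem snd_deriv_of_comp_eq_on_parabola {T X U : Pt → ℝ} {p : Pt} (hT : ContDiffAt ℝ 2 T p)
    (hX : ContDiffAt ℝ 2 X p) (hU : ContDiffAt ℝ 2 U p) {g : ℝ × ℝ → ℝ}
    (hg : ContDiffAt ℝ 2 g (T p, X p)) {w : Pt} (κ : ℝ) (hw : fderiv ℝ T p w = 0)
    (h : ∀ᶠ s : ℝ in 𝓝 0, g (T (p + s • w + (s ^ 2 / 2 * κ) • eU),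
      X (p + s • w + (s ^ 2 / 2 * κ) • eU)) = U (p + s • w + (s ^ 2 / 2 * κ) • eU)) :
    fderiv ℝ X p w ^ 2 * fderiv ℝ (fderiv ℝ g) (T p, X p) (0, 1) (0, 1)
      + fderiv ℝ g (T p, X p) (1, 0) * (fderiv ℝ (fderiv ℝ T) p w w + κ * pd eU T p)
      + fderiv ℝ g (T p, X p) (0, 1) * (fderiv ℝ (fderiv ℝ X) p w w + κ * pd eU X p)
      = fderiv ℝ (fderiv ℝ U) p w w + κ * pd eU U p := by
  have h0 : p + (0 : ℝ) • w + ((0 : ℝ) ^ 2 / 2 * κ) • eU = p := by simp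
  have h0' : w + ((0 : ℝ) * κ) • eU = w := by simp
  have key : ∀ {F : Pt → ℝ}, ContDiffAt ℝ 2 F p → _ := fun {F} hF =>
    eventually_hasDerivAt_comp_curve (F := F)
      (γ := fun s : ℝ => p + s • w + (s ^ 2 / 2 * κ) • eU) (by simpa only [h0] using hF)
      (Eventually.of_forall (hasDerivAt_parabola p w κ)) (hasDerivAt_parabola' w κ 0)
  simp only [h0, h0', map_smul, smul_eq_mul] at key
  have hη := ((key hT).1.and (key hX).1).mono fun s hs => hs.1.prodMk hs.2
  have hη' := (key hT).2.prodMk (key hX).2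
  -- The curve for `g` is `(T, X)` along the parabola; its velocity at `0` is vertical by `hw`, so
  -- only the pure `X`-derivative of second order survives.
  have hG := eventually_hasDerivAt_comp_curve (F := g) (by simpa only [h0] using hg) hη hη'
  have := snd_deriv_unique h hG.1 hG.2 (key hU).1 (key hU).2
  simp only [h0, h0', hw] at this
  have hlin : ∀ y z : ℝ, fderiv ℝ g (T p, X p) (y, z)
      = fderiv ℝ g (T p, X p) (1, 0) * y + fderiv ℝ g (T p, X p) (0, 1) * z := fun y z => by
    have : (y, z) = y • ((1, 0) : ℝ × ℝ) + z • ((0, 1) : ℝ × ℝ) := by simp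
    rw [this, map_add, map_smul, map_smul, smul_eq_mul, smul_eq_mul, mul_comm, mul_comm z]
  have hj : ((0, fderiv ℝ X p w) : ℝ × ℝ) = fderiv ℝ X p w • ((0, 1) : ℝ × ℝ) := by simp
  rw [hlin, hj] at this
  simp only [map_smul, smul_apply, smul_eq_mul] at this
  simp only [pd]
  linear_combination this

/-! ### Partial derivatives, test polynomials and images of graphs -/

theorem fst_deriv_eq {g : ℝ × ℝ → ℝ} {t x : ℝ} (hg : DifferentiableAt ℝ g (t, x)) :
    deriv (fun s => g (s, x)) t = fderiv ℝ g (t, x) (1, 0) :=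
  (hg.hasFDerivAt.comp_hasDerivAt t ((hasDerivAt_id t).prodMk (hasDerivAt_const t x))).deriv

theorem snd_deriv_eq {g : ℝ × ℝ → ℝ} {t x : ℝ} (hg : DifferentiableAt ℝ g (t, x)) :
    deriv (fun y => g (t, y)) x = fderiv ℝ g (t, x) (0, 1) :=
  (hg.hasFDerivAt.comp_hasDerivAt x ((hasDerivAt_const x t).prodMk (hasDerivAt_id x))).deriv

theorem snd_snd_deriv_eq {g : ℝ × ℝ → ℝ} {t x : ℝ} (hg : ContDiffAt ℝ 2 g (t, x)) :
    deriv (fun z => deriv (fun y => g (t, y)) z) x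
      = fderiv ℝ (fderiv ℝ g) (t, x) (0, 1) (0, 1) := by
  have h1 : ∀ᶠ z in 𝓝 x, deriv (fun y => g (t, y)) z = fderiv ℝ g (t, z) (0, 1) := by
    have : Tendsto (fun s : ℝ => (t, s)) (𝓝 x) (𝓝 (t, x)) :=
      (Continuous.prodMk_right t).tendsto x
    filter_upwards [this.eventually (hg.eventually (by simp))] with z hz
    exact snd_deriv_eq (hz.differentiableAt (by simp))
  rw [EventuallyEq.deriv_eq h1]
  have h2 : HasFDerivAt (fderiv ℝ g) (fderiv ℝ (fderiv ℝ g) (t, x)) (t, x) :=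
    ((hg.fderiv_right (m := 1) (by norm_num)).differentiableAt (by simp)).hasFDerivAt
  have h3 := (h2.comp_hasDerivAt x ((hasDerivAt_const x t).prodMk (hasDerivAt_id x))).clm_apply
    (hasDerivAt_const x ((0, 1) : ℝ × ℝ))
  simpa using h3.deriv

/-- The polynomial with prescribed 2-jet at `(t, x)`, without mixed term. -/
noncomputable def quadratic (t x u a b e q : ℝ) (z : ℝ × ℝ) : ℝ :=
  u + a * (z.1 - t) + b * (z.2 - x) + e / 2 * (z.2 - x) ^ 2 + q / 2 * (z.1 - t) ^ 2

theorem contDiff_quadratic (t x u a b e q : ℝ) : ContDiff ℝ ∞ (quadratic t x u a b e q) := by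
  unfold quadratic
  fun_prop

theorem quadratic_self (t x u a b e q : ℝ) : quadratic t x u a b e q (t, x) = u := by
  simp [quadratic]

theorem hasFDerivAt_quadratic (t x u a b e q : ℝ) :
    HasFDerivAt (quadratic t x u a b e q)
      (a • ContinuousLinearMap.fst ℝ ℝ ℝ + b • ContinuousLinearMap.snd ℝ ℝ ℝ) (t, x) := by
  have h1 : HasFDerivAt (fun z : ℝ × ℝ => z.1 - t) (ContinuousLinearMap.fst ℝ ℝ ℝ) (t, x) :=
    hasFDerivAt_fst.sub_const t
  have h2 : HasFDerivAt (fun z : ℝ × ℝ => z.2 - x) (ContinuousLinearMap.snd ℝ ℝ ℝ) (t, x) :=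
    hasFDerivAt_snd.sub_const x
  have := ((((h1.const_mul a).const_add u).add (h2.const_mul b)).add
    ((h2.pow 2).const_mul (e / 2))).add ((h1.pow 2).const_mul (q / 2))
  refine HasFDerivAt.congr_fderiv this ?_
  simp

theorem satisfiesAt_quadratic (c : Coeff) (t x u a b e q : ℝ) :
    SatisfiesAt c (quadratic t x u a b e q) t x ↔ a = e - c.toFun t * u ^ 3 := by
  have hd : ∀ z : ℝ, deriv (fun y => quadratic t x u a b e q (t, y)) z = b + e * (z - x) := by
    intro z
    have h2 : HasDerivAt (fun y : ℝ => y - x) 1 z := (hasDerivAt_id z).sub_const x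
    have := (((h2.const_mul b).const_add (u + a * (t - t))).add
      ((h2.pow 2).const_mul (e / 2))).add_const (q / 2 * (t - t) ^ 2)
    refine this.deriv.trans ?_
    push_cast
    ring
  have hdd : deriv (fun z => b + e * (z - x)) x = e := by
    simp
  have ht : deriv (fun s => quadratic t x u a b e q (s, x)) t = a := by
    rw [fst_deriv_eq (hasFDerivAt_quadratic ..).differentiableAt, (hasFDerivAt_quadratic ..).fderiv]
    simp
  simp only [SatisfiesAt, hd, hdd, ht, quadratic_self]

theorem contDiffAt_two {E F : Type*} [NormedAddCommGroup E] [NormedSpace ℝ E]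
    [NormedAddCommGroup F] [NormedSpace ℝ F] {f : E → F} {x : E} (h : ContDiffAt ℝ ∞ f x) :
    ContDiffAt ℝ 2 f x :=
  mod_cast contDiffAt_infty.1 h 2

/-- The image of a graph under `(T, X, U)` is a graph near every point where the total Jacobian
of `(T, X)` does not vanish. -/
theorem exists_graph_image {T X U : Pt → ℝ} {p : Pt} (hT : ContDiffAt ℝ ∞ T p)
    (hX : ContDiffAt ℝ ∞ X p) (hU : ContDiffAt ℝ ∞ U p) {f : ℝ × ℝ → ℝ}
    (hf : ContDiff ℝ ∞ f) (hfp : f (p.1, p.2.1) = p.2.2) {a b : ℝ}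
    (hf' : HasFDerivAt f
      (a • ContinuousLinearMap.fst ℝ ℝ ℝ + b • ContinuousLinearMap.snd ℝ ℝ ℝ) (p.1, p.2.1))
    (hJ : (pd eT T p + a * pd eU T p) * (pd eX X p + b * pd eU X p)
      - (pd eX T p + b * pd eU T p) * (pd eT X p + a * pd eU X p) ≠ 0) :
    ∃ g : ℝ × ℝ → ℝ, ContDiffAt ℝ ∞ g (T p, X p) ∧
      (∀ᶠ z : ℝ × ℝ in 𝓝 (p.1, p.2.1),
        g (T (z.1, z.2, f z), X (z.1, z.2, f z)) = U (z.1, z.2, f z)) ∧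
      fderiv ℝ g (T p, X p) (1, 0) * (pd eT T p + a * pd eU T p)
        + fderiv ℝ g (T p, X p) (0, 1) * (pd eT X p + a * pd eU X p) = pd eT U p + a * pd eU U p ∧
      fderiv ℝ g (T p, X p) (1, 0) * (pd eX T p + b * pd eU T p)
        + fderiv ℝ g (T p, X p) (0, 1) * (pd eX X p + b * pd eU X p)
        = pd eX U p + b * pd eU U p := by
  obtain ⟨t, x, u⟩ := p
  simp only at hfp hf' ⊢
  set p : Pt := (t, x, u) with hp
  set ι : ℝ × ℝ → Pt := fun z => (z.1, z.2, f z) with hι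
  have hιp : ι (t, x) = p := by simp [hι, hfp, hp]
  have hιs : ContDiff ℝ ∞ ι := contDiff_fst.prodMk (contDiff_snd.prodMk hf)
  set ι' := (ContinuousLinearMap.fst ℝ ℝ ℝ).prod ((ContinuousLinearMap.snd ℝ ℝ ℝ).prod
    (a • ContinuousLinearMap.fst ℝ ℝ ℝ + b • ContinuousLinearMap.snd ℝ ℝ ℝ)) with hι'
  have hιd : HasFDerivAt ι ι' (t, x) := hasFDerivAt_fst.prodMk (hasFDerivAt_snd.prodMk hf')
  have hcomp : ∀ {F : Pt → ℝ}, ContDiffAt ℝ ∞ F p →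
      ContDiffAt ℝ ∞ (fun z => F (ι z)) (t, x) ∧
      HasFDerivAt (fun z => F (ι z)) ((fderiv ℝ F p).comp ι') (t, x) := by
    intro F hF
    refine ⟨ContDiffAt.comp (t, x) (by rwa [hιp]) hιs.contDiffAt, ?_⟩
    refine HasFDerivAt.comp (t, x) ?_ hιd
    rw [hιp]
    exact (hF.differentiableAt (by simp)).hasFDerivAt
  have happ : ∀ (F : Pt → ℝ) (v : ℝ × ℝ), (fderiv ℝ F p).comp ι' v
      = v.1 * (pd eT F p + a * pd eU F p) + v.2 * (pd eX F p + b * pd eU F p) := by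
    intro F v
    rw [ContinuousLinearMap.comp_apply, fderiv_apply_eq_pd]
    simp only [hι', ContinuousLinearMap.prod_apply, ContinuousLinearMap.coe_fst',
      ContinuousLinearMap.coe_snd', add_apply, smul_apply,
      smul_eq_mul]
    ring
  set θ : ℝ × ℝ → ℝ × ℝ := fun z => (T (ι z), X (ι z)) with hθ
  have hθs : ContDiffAt ℝ ∞ θ (t, x) := (hcomp hT).1.prodMk (hcomp hX).1
  set M : ℝ × ℝ →L[ℝ] ℝ × ℝ := ((fderiv ℝ T p).comp ι').prod ((fderiv ℝ X p).comp ι') with hM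
  -- `M` is the total derivative of `(T, X)` along the graph; the expression in `hJ` is its
  -- determinant, and Cramer's rule gives injectivity.
  have hMi : Function.Injective M := by
    rw [injective_iff_map_eq_zero]
    intro v hv
    rw [hM, ContinuousLinearMap.prod_apply, Prod.mk_eq_zero, happ, happ] at hv
    have h1 : v.1 * ((pd eT T p + a * pd eU T p) * (pd eX X p + b * pd eU X p)
        - (pd eX T p + b * pd eU T p) * (pd eT X p + a * pd eU X p)) = 0 := by
      linear_combination (pd eX X p + b * pd eU X p) * hv.1
      - (pd eX T p + b * pd eU T p) * hv.2
    have h2 : v.2 * ((pd eT T p + a * pd eU T p) * (pd eX X p + b * pd eU X p)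
        - (pd eX T p + b * pd eU T p) * (pd eT X p + a * pd eU X p)) = 0 := by
      linear_combination (pd eT T p + a * pd eU T p) * hv.2
      - (pd eT X p + a * pd eU X p) * hv.1
    exact Prod.ext ((mul_eq_zero.1 h1).resolve_right hJ) ((mul_eq_zero.1 h2).resolve_right hJ)
  set N : (ℝ × ℝ) ≃L[ℝ] ℝ × ℝ :=
    (LinearEquiv.ofInjectiveEndo (M : ℝ × ℝ →ₗ[ℝ] ℝ × ℝ) hMi).toContinuousLinearEquiv
  have hN : (N : ℝ × ℝ →L[ℝ] ℝ × ℝ) = M := by ext <;> rfl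
  have hθd : HasFDerivAt θ (N : ℝ × ℝ →L[ℝ] ℝ × ℝ) (t, x) := by
    rw [hN]
    exact (hcomp hT).2.prodMk (hcomp hX).2
  have hn : (∞ : WithTop ℕ∞) ≠ 0 := by simp
  have hθp : θ (t, x) = (T p, X p) := by simp only [hθ, hιp]
  -- The image graph is that of `U ∘ ι ∘ θ⁻¹`, with the local inverse supplied by the inverse
  -- function theorem.
  have hgs : ContDiffAt ℝ ∞ (fun z => U (ι (hθs.localInverse hθd hn z))) (T p, X p) := by
    rw [← hθp]
    refine ContDiffAt.comp (θ (t, x)) (g := fun z => U (ι z)) ?_ (hθs.to_localInverse hθd hn)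
    rw [hθs.localInverse_apply_image hθd hn]
    exact (hcomp hU).1
  have hinv : ∀ᶠ z in 𝓝 (t, x), hθs.localInverse hθd hn (θ z) = z :=
    (hθs.hasStrictFDerivAt' hθd hn).eventually_left_inverse
  have hgr : ∀ᶠ z in 𝓝 (t, x), (fun z => U (ι (hθs.localInverse hθd hn z))) (θ z) = U (ι z) := by
    filter_upwards [hinv] with z hz
    simp only [hz]
  refine ⟨fun z => U (ι (hθs.localInverse hθd hn z)), hgs, hgr, ?_⟩
  -- Only `g ∘ θ = U ∘ ι` near the point matters from here; its derivative in the two coordinate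
  -- directions yields the two linear relations.
  generalize (fun z => U (ι (hθs.localInverse hθd hn z))) = g at hgs hgr
  have hgd : HasFDerivAt (fun z => g (θ z)) ((fderiv ℝ g (T p, X p)).comp M) (t, x) := by
    rw [hN] at hθd
    refine HasFDerivAt.comp (t, x) ?_ hθd
    rw [hθp]
    exact (hgs.differentiableAt (by simp)).hasFDerivAt
  have heq := (hgd.congr_of_eventuallyEq (EventuallyEq.symm hgr)).unique (hcomp hU).2
  have hlin : ∀ y z : ℝ, fderiv ℝ g (T p, X p) (y, z)
      = fderiv ℝ g (T p, X p) (1, 0) * y + fderiv ℝ g (T p, X p) (0, 1) * z := fun y z => by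
    have : (y, z) = y • ((1, 0) : ℝ × ℝ) + z • ((0, 1) : ℝ × ℝ) := by simp
    rw [this, map_add, map_smul, map_smul, smul_eq_mul, smul_eq_mul, mul_comm, mul_comm z]
  have hv : ∀ v : ℝ × ℝ, fderiv ℝ g (T p, X p) (M v) = (fderiv ℝ U p).comp ι' v := fun v =>
    congrArg (fun A : ℝ × ℝ →L[ℝ] ℝ => A v) heq
  have hMv : ∀ v : ℝ × ℝ, M v = ((fderiv ℝ T p).comp ι' v, (fderiv ℝ X p).comp ι' v) :=
    fun v => rfl
  simp only [hMv, happ, hlin (_ + _)] at hv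
  constructor
  · simpa using hv (1, 0)
  · simpa using hv (0, 1)

/-- The condition that the transformation `(T, X, U)` takes 2-jets satisfying one equation to 2-jets
satisfying the other, at a jet with the first derivatives `a`, `b` (of `u` by `t` and `x`) and
`q` (of `u` by `t` twice). -/
theorem MapsEquation.prolongation {c d : Coeff} {Ω : Set Pt} {T X U : Pt → ℝ}
    (hΦ : IsPointTransformation Ω fun p => (T p, X p, U p))
    (h : MapsEquation c d Ω fun p => (T p, X p, U p)) {p : Pt} (hp : p ∈ Ω) (a b q gT gX : ℝ)
    (hJ : (pd eT T p + a * pd eU T p) * (pd eX X p + b * pd eU X p)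
      - (pd eX T p + b * pd eU T p) * (pd eT X p + a * pd eU X p) ≠ 0)
    (hgT : gT * (pd eT T p + a * pd eU T p) + gX * (pd eT X p + a * pd eU X p)
      = pd eT U p + a * pd eU U p)
    (hgX : gT * (pd eX T p + b * pd eU T p) + gX * (pd eX X p + b * pd eU X p)
      = pd eX U p + b * pd eU U p)
    {w : Pt} (hw : w = (-(pd eX T p + b * pd eU T p), pd eT T p + a * pd eU T p,
      -(pd eX T p + b * pd eU T p) * a + (pd eT T p + a * pd eU T p) * b))
    {κ : ℝ} (hκ : κ = (a + c.toFun p.1 * p.2.2 ^ 3) * (pd eT T p + a * pd eU T p) ^ 2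
      + q * (pd eX T p + b * pd eU T p) ^ 2) :
    fderiv ℝ X p w ^ 2 * (gT + d.toFun (T p) * U p ^ 3)
      + gT * (fderiv ℝ (fderiv ℝ T) p w w + κ * pd eU T p)
      + gX * (fderiv ℝ (fderiv ℝ X) p w w + κ * pd eU X p)
      = fderiv ℝ (fderiv ℝ U) p w w + κ * pd eU U p := by
  have hs : ContDiffAt ℝ ∞ (fun p => (T p, X p, U p)) p :=
    hΦ.smooth.contDiffAt (hΦ.isOpen.mem_nhds hp)
  have hT : ContDiffAt ℝ ∞ T p := hs.fst
  have hX : ContDiffAt ℝ ∞ X p := hs.snd.fst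
  have hU : ContDiffAt ℝ ∞ U p := hs.snd.snd
  -- This value of `u_xx` makes the test polynomial satisfy the source equation at the point,
  -- whatever `a`, `b`, `q` are.
  set e := a + c.toFun p.1 * p.2.2 ^ 3 with he
  set f := quadratic p.1 p.2.1 p.2.2 a b e q with hf
  have hfp : f (p.1, p.2.1) = p.2.2 := quadratic_self ..
  obtain ⟨g, hg, hfg, h1, h2⟩ := exists_graph_image hT hX hU (contDiff_quadratic ..) hfp
    (hasFDerivAt_quadratic ..) hJ
  -- `gT` and `gX` solve the same linear system as the derivatives of `g`, and its determinant is
  -- nonzero.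
  have hgT' : fderiv ℝ g (T p, X p) (1, 0) = gT := by
    apply mul_left_cancel₀ hJ
    linear_combination (pd eX X p + b * pd eU X p) * (h1 - hgT)
      - (pd eT X p + a * pd eU X p) * (h2 - hgX)
  have hgX' : fderiv ℝ g (T p, X p) (0, 1) = gX := by
    apply mul_left_cancel₀ hJ
    linear_combination (pd eT T p + a * pd eU T p) * (h2 - hgX)
      - (pd eX T p + b * pd eU T p) * (h1 - hgT)
  have hpf : ((p.1, p.2.1, f (p.1, p.2.1)) : Pt) = p := by rw [hfp]
  have hjet := h.jets f g p.1 p.2.1 (by rwa [hpf]) (contDiff_quadratic ..).contDiffAt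
    (by simpa only [hpf] using hg) hfg
  simp only [hpf] at hjet
  have hsat := hjet.1 ((satisfiesAt_quadratic ..).2 (by rw [he]; ring))
  have hgp : g (T p, X p) = U p := by
    have := hfg.self_of_nhds
    rwa [hpf] at this
  rw [SatisfiesAt, fst_deriv_eq (hg.differentiableAt (by simp)),
    snd_snd_deriv_eq (contDiffAt_two hg), hgp, hgT'] at hsat
  have hTw : fderiv ℝ T p w = 0 := by
    rw [fderiv_apply_eq_pd, hw]
    ring
  -- The graph of the quadratic `f` over a line is exactly a parabola; `κ` is the second derivative
  -- of `f` along that line, with no mixed contribution.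
  have hcurve : ∀ s : ℝ, p + s • w + (s ^ 2 / 2 * κ) • eU
      = ((p.1 + s * w.1, p.2.1 + s * w.2.1, f (p.1 + s * w.1, p.2.1 + s * w.2.1)) : Pt) := by
    intro s
    rw [hf, hw, hκ]
    refine Prod.ext ?_ (Prod.ext ?_ ?_) <;> simp [eU, quadratic]
    ring
  have hlim : Tendsto (fun s : ℝ => (p.1 + s * w.1, p.2.1 + s * w.2.1)) (𝓝 0)
      (𝓝 (p.1, p.2.1)) := by
    have : Continuous (fun s : ℝ => (p.1 + s * w.1, p.2.1 + s * w.2.1)) := by fun_prop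
    simpa using this.tendsto 0
  have := snd_deriv_of_comp_eq_on_parabola (contDiffAt_two hT) (contDiffAt_two hX)
    (contDiffAt_two hU) (contDiffAt_two hg) κ hTw (by
      filter_upwards [hlim.eventually hfg] with s hs
      rw [hcurve]
      exact hs)
  rw [hgT', hgX'] at this
  rw [← this, hsat]
  ring

/-! ### Calculus of directional derivatives -/

theorem hasLineDerivAt_pd {Ω : Set Pt} (hΩ : IsOpen Ω) {F : Pt → ℝ} (hF : ContDiffOn ℝ ∞ F Ω)
    {p : Pt} (hp : p ∈ Ω) (v : Pt) : HasLineDerivAt ℝ F (pd v F p) p v :=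
  ((hF.contDiffAt (hΩ.mem_nhds hp)).differentiableAt (by simp)).hasFDerivAt.hasLineDerivAt v

theorem contDiffOn_pd {Ω : Set Pt} (hΩ : IsOpen Ω) {F : Pt → ℝ} (hF : ContDiffOn ℝ ∞ F Ω)
    (v : Pt) : ContDiffOn ℝ ∞ (pd v F) Ω :=
  (hF.fderiv_of_isOpen hΩ (m := ∞) (by simp)).clm_apply contDiffOn_const

theorem fderiv_fderiv_apply {Ω : Set Pt} (hΩ : IsOpen Ω) {F : Pt → ℝ} (hF : ContDiffOn ℝ ∞ F Ω)
    {p : Pt} (hp : p ∈ Ω) (v w : Pt) :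
    fderiv ℝ (fderiv ℝ F) p v w = pd v (pd w F) p := by
  have h1 : DifferentiableAt ℝ (fderiv ℝ F) p :=
    ((hF.fderiv_of_isOpen hΩ (m := ∞) (by simp)).contDiffAt (hΩ.mem_nhds hp)).differentiableAt
      (by simp)
  have h2 : HasFDerivAt (pd w F) _ p := h1.hasFDerivAt.clm_apply (hasFDerivAt_const w p)
  rw [pd, h2.fderiv]
  simp

theorem pd_comm {Ω : Set Pt} (hΩ : IsOpen Ω) {F : Pt → ℝ} (hF : ContDiffOn ℝ ∞ F Ω)
    {p : Pt} (hp : p ∈ Ω) (v w : Pt) : pd v (pd w F) p = pd w (pd v F) p := by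
  rw [← fderiv_fderiv_apply hΩ hF hp, ← fderiv_fderiv_apply hΩ hF hp]
  have hF2 := contDiffAt_two (hF.contDiffAt (hΩ.mem_nhds hp))
  exact hF2.isSymmSndFDerivAt (by simp) v w

theorem pd_congr {Ω : Set Pt} (hΩ : IsOpen Ω) {F G : Pt → ℝ} (h : ∀ q ∈ Ω, F q = G q)
    {p : Pt} (hp : p ∈ Ω) (v : Pt) : pd v F p = pd v G p := by
  have : F =ᶠ[𝓝 p] G := by filter_upwards [hΩ.mem_nhds hp] with q hq using h q hq
  rw [pd, this.fderiv_eq, pd]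

theorem pd_eq_zero_of_eqOn_const {Ω : Set Pt} (hΩ : IsOpen Ω) {F : Pt → ℝ} {k : ℝ}
    (h : ∀ q ∈ Ω, F q = k) {p : Pt} (hp : p ∈ Ω) (v : Pt) : pd v F p = 0 := by
  rw [pd_congr hΩ h hp, pd, fderiv_const_apply]
  rfl

/-- The device by which identities on `Ω` are differentiated: each side is given its derivative by
the product and chain rules below, and the two values must agree. -/
theorem lineDeriv_unique {Ω : Set Pt} (hΩ : IsOpen Ω) {F G : Pt → ℝ} (h : ∀ q ∈ Ω, F q = G q)
    {p v : Pt} (hp : p ∈ Ω) {a b : ℝ} (hF : HasLineDerivAt ℝ F a p v)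
    (hG : HasLineDerivAt ℝ G b p v) : a = b := by
  have : F =ᶠ[𝓝 p] G := by filter_upwards [hΩ.mem_nhds hp] with q hq using h q hq
  exact (hF.congr_of_eventuallyEq this.symm).unique hG

theorem lineDeriv_mul {F G : Pt → ℝ} {p v : Pt} {a b : ℝ} (hF : HasLineDerivAt ℝ F a p v)
    (hG : HasLineDerivAt ℝ G b p v) :
    HasLineDerivAt ℝ (fun q => F q * G q) (a * G p + F p * b) p v := by
  have := HasDerivAt.fun_mul hF hG
  simp only [zero_smul, add_zero] at this
  exact this

theorem lineDeriv_pow {F : Pt → ℝ} {p v : Pt} {a : ℝ} (n : ℕ) (hF : HasLineDerivAt ℝ F a p v) :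
    HasLineDerivAt ℝ (fun q => F q ^ n) (n * F p ^ (n - 1) * a) p v := by
  have := HasDerivAt.fun_pow hF n
  simp only [zero_smul, add_zero] at this
  exact this

theorem lineDeriv_add {F G : Pt → ℝ} {p v : Pt} {a b : ℝ} (hF : HasLineDerivAt ℝ F a p v)
    (hG : HasLineDerivAt ℝ G b p v) : HasLineDerivAt ℝ (fun q => F q + G q) (a + b) p v :=
  HasDerivAt.fun_add hF hG

theorem lineDeriv_sub {F G : Pt → ℝ} {p v : Pt} {a b : ℝ} (hF : HasLineDerivAt ℝ F a p v)
    (hG : HasLineDerivAt ℝ G b p v) : HasLineDerivAt ℝ (fun q => F q - G q) (a - b) p v :=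
  HasDerivAt.fun_sub hF hG

theorem lineDeriv_comp {φ : ℝ → ℝ} {F : Pt → ℝ} {p v : Pt} {a : ℝ}
    (hφ : DifferentiableAt ℝ φ (F p)) (hF : HasLineDerivAt ℝ F a p v) :
    HasLineDerivAt ℝ (fun q => φ (F q)) (deriv φ (F p) * a) p v :=
  HasDerivAt.comp (0 : ℝ) (by simpa using hφ.hasDerivAt) hF

theorem lineDeriv_fst (p v : Pt) : HasLineDerivAt ℝ (fun q : Pt => q.1) v.1 p v :=
  (hasFDerivAt_fst (𝕜 := ℝ) (p := p)).hasLineDerivAt v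

theorem lineDeriv_snd_snd (p v : Pt) : HasLineDerivAt ℝ (fun q : Pt => q.2.2) v.2.2 p v := by
  have h : HasFDerivAt (fun q : Pt => q.2.2) ((ContinuousLinearMap.snd ℝ ℝ ℝ).comp
    (ContinuousLinearMap.snd ℝ ℝ (ℝ × ℝ))) p :=
    ((ContinuousLinearMap.snd ℝ ℝ ℝ).comp (ContinuousLinearMap.snd ℝ ℝ (ℝ × ℝ))).hasFDerivAt
  exact h.hasLineDerivAt v

/-- On a connected open set, functions with equal derivatives differ by a constant; here the
comparison is with a linear form. -/
theorem exists_eq_affine_of_pd_const {Ω : Set Pt} (hΩ : IsOpen Ω) (hc : IsConnected Ω)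
    {F : Pt → ℝ} (hF : ContDiffOn ℝ ∞ F Ω) {α β γ : ℝ} (h1 : ∀ p ∈ Ω, pd eT F p = α)
    (h2 : ∀ p ∈ Ω, pd eX F p = β) (h3 : ∀ p ∈ Ω, pd eU F p = γ) :
    ∃ k, ∀ p ∈ Ω, F p = α * p.1 + β * p.2.1 + γ * p.2.2 + k := by
  set G : Pt →L[ℝ] ℝ := α • ContinuousLinearMap.fst ℝ ℝ (ℝ × ℝ)
    + β • (ContinuousLinearMap.fst ℝ ℝ ℝ).comp (ContinuousLinearMap.snd ℝ ℝ (ℝ × ℝ))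
    + γ • (ContinuousLinearMap.snd ℝ ℝ ℝ).comp (ContinuousLinearMap.snd ℝ ℝ (ℝ × ℝ))
  have hG : ∀ p : Pt, G p = α * p.1 + β * p.2.1 + γ * p.2.2 := fun p => rfl
  obtain ⟨k, hk⟩ := hΩ.exists_eq_add_of_fderiv_eq hc.isPreconnected
    (hF.differentiableOn (by simp)) G.differentiableOn fun p hp => by
      refine ContinuousLinearMap.ext fun v => ?_
      rw [fderiv_apply_eq_pd, h1 p hp, h2 p hp, h3 p hp, G.fderiv, hG]
      ring
  exact ⟨k, fun p hp => (hk hp).trans (by rw [← hG])⟩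

theorem exists_eq_const_of_pd_eq_zero {Ω : Set Pt} (hΩ : IsOpen Ω) (hc : IsConnected Ω)
    {F : Pt → ℝ} (hF : ContDiffOn ℝ ∞ F Ω) (h1 : ∀ p ∈ Ω, pd eT F p = 0)
    (h2 : ∀ p ∈ Ω, pd eX F p = 0) (h3 : ∀ p ∈ Ω, pd eU F p = 0) : ∃ k, ∀ p ∈ Ω, F p = k := by
  obtain ⟨k, hk⟩ := exists_eq_affine_of_pd_const hΩ hc hF h1 h2 h3
  exact ⟨k, fun p hp => by rw [hk p hp]; ring⟩

/-! ### The determining equations -/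

section Determining

variable {c d : Coeff} {Ω : Set Pt} {T X U : Pt → ℝ}

/-- The expression is the determinant of the Jacobian matrix expanded along the row of `U`. Were it
zero, a kernel vector would contradict the injectivity of the derivative. -/
theorem jacobian_ne_zero (hΦ : IsPointTransformation Ω fun p => (T p, X p, U p)) {p : Pt}
    (hp : p ∈ Ω) :
    pd eU U p * (pd eT T p * pd eX X p - pd eX T p * pd eT X p)
      - pd eX U p * (pd eT T p * pd eU X p - pd eU T p * pd eT X p)
      - pd eT U p * (pd eU T p * pd eX X p - pd eX T p * pd eU X p) ≠ 0 := by
  intro h0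
  have hs : ContDiffAt ℝ ∞ (fun p => (T p, X p, U p)) p :=
    hΦ.smooth.contDiffAt (hΦ.isOpen.mem_nhds hp)
  have hd : HasFDerivAt (fun p => (T p, X p, U p))
      ((fderiv ℝ T p).prod ((fderiv ℝ X p).prod (fderiv ℝ U p))) p :=
    (hs.fst.differentiableAt (by simp)).hasFDerivAt.prodMk
      ((hs.snd.fst.differentiableAt (by simp)).hasFDerivAt.prodMk
        (hs.snd.snd.differentiableAt (by simp)).hasFDerivAt)
  have hi := (hΦ.nondegenerate p hp).injective
  rw [hd.fderiv] at hi
  set M : Matrix (Fin 3) (Fin 3) ℝ := !![pd eT T p, pd eX T p, pd eU T p;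
    pd eT X p, pd eX X p, pd eU X p; pd eT U p, pd eX U p, pd eU U p] with hM
  have hdet : M.det = 0 := by
    rw [Matrix.det_fin_three]
    simp only [hM, Matrix.of_apply, Matrix.cons_val]
    linear_combination h0
  obtain ⟨v, hv, hMv⟩ := Matrix.exists_mulVec_eq_zero_iff.2 hdet
  have e0 := congrFun hMv 0
  have e1 := congrFun hMv 1
  have e2 := congrFun hMv 2
  simp only [hM, Matrix.mulVec, dotProduct, Fin.sum_univ_three, Matrix.of_apply, Matrix.cons_val,
    Pi.zero_apply] at e0 e1 e2
  have hz : ((v 0, v 1, v 2) : Pt) = 0 := by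
    apply hi
    rw [map_zero]
    refine Prod.ext ?_ (Prod.ext ?_ ?_)
    · exact (fderiv_apply_eq_pd T p _).trans (by refine Eq.trans ?_ e0; dsimp only; ring)
    · exact (fderiv_apply_eq_pd X p _).trans (by refine Eq.trans ?_ e1; dsimp only; ring)
    · exact (fderiv_apply_eq_pd U p _).trans (by refine Eq.trans ?_ e2; dsimp only; ring)
  simp only [Prod.mk_eq_zero] at hz
  apply hv
  ext i
  fin_cases i
  · exact hz.1
  · exact hz.2.1
  · exact hz.2.2

theorem IsPointTransformation.contDiffOn_components
    (hΦ : IsPointTransformation Ω fun p => (T p, X p, U p)) :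
    ContDiffOn ℝ ∞ T Ω ∧ ContDiffOn ℝ ∞ X Ω ∧ ContDiffOn ℝ ∞ U Ω :=
  ⟨hΦ.smooth.fst, hΦ.smooth.snd.fst, hΦ.smooth.snd.snd⟩

/-- The time component does not depend on `x` and `u`. -/
theorem pd_time_eq_zero (h : IsAdmissible c d Ω fun p => (T p, X p, U p)) {p : Pt} (hp : p ∈ Ω) :
    pd eX T p = 0 ∧ pd eU T p = 0 := by
  have hdet := jacobian_ne_zero h.pointTransformation hp
  have key : ∀ a b : ℝ, ((pd eT T p + a * pd eU T p) * (pd eX X p + b * pd eU X p)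
      - (pd eX T p + b * pd eU T p) * (pd eT X p + a * pd eU X p))
        * (pd eX T p + b * pd eU T p) = 0 := by
    intro a b
    by_contra hne
    have hJ := left_ne_zero_of_mul hne
    have hT := right_ne_zero_of_mul hne
    set J := (pd eT T p + a * pd eU T p) * (pd eX X p + b * pd eU X p)
      - (pd eX T p + b * pd eU T p) * (pd eT X p + a * pd eU X p) with hJdef
    -- Cramer's formulas for the derivatives of `g`.
    obtain ⟨gT, hgT⟩ : ∃ gT, J * gT = (pd eT U p + a * pd eU U p) * (pd eX X p + b * pd eU X p)
        - (pd eX U p + b * pd eU U p) * (pd eT X p + a * pd eU X p) :=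
      ⟨_, mul_div_cancel₀ _ hJ⟩
    obtain ⟨gX, hgX⟩ : ∃ gX, J * gX = (pd eX U p + b * pd eU U p) * (pd eT T p + a * pd eU T p)
        - (pd eT U p + a * pd eU U p) * (pd eX T p + b * pd eU T p) :=
      ⟨_, mul_div_cancel₀ _ hJ⟩
    have hpro := fun q => h.mapsEquation.prolongation h.pointTransformation hp a b q gT gX hJ
      (by
        apply mul_left_cancel₀ hJ
        linear_combination (pd eT T p + a * pd eU T p) * hgT + (pd eT X p + a * pd eU X p) * hgX
          + (pd eT U p + a * pd eU U p) * hJdef)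
      (by
        apply mul_left_cancel₀ hJ
        linear_combination (pd eX T p + b * pd eU T p) * hgT + (pd eX X p + b * pd eU X p) * hgX
          + (pd eX U p + b * pd eU U p) * hJdef)
      rfl rfl
    -- The identity is affine in `q`, which enters only through `κ`; this is its coefficient.
    have h0 : (pd eU U p - gT * pd eU T p - gX * pd eU X p)
        * (pd eX T p + b * pd eU T p) ^ 2 = 0 := by
      linear_combination hpro 0 - hpro 1
    have hK := (mul_eq_zero.1 h0).resolve_right (pow_ne_zero 2 hT)
    apply hdet
    -- `J` times the vanishing factor is the full Jacobian determinant.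
    linear_combination J * hK + pd eU T p * hgT + pd eU X p * hgX - pd eU U p * hJdef
  set m := pd eT T p * pd eX X p - pd eX T p * pd eT X p with hm
  set n := pd eU T p * pd eX X p - pd eX T p * pd eU X p with hn
  set l := pd eT T p * pd eU X p - pd eU T p * pd eT X p with hl
  -- `key` says that `(m + a n + b l)(T_x + b T_u)` vanishes identically in `a` and `b`; sample
  -- values extract its coefficients `f1` to `f5`, and the determinant is `U_u m - U_x l - U_t n`.
  have k1 := key 0 0
  have k2 := key 1 0
  have k3 := key 0 1
  have k4 := key 0 (-1)
  have k5 := key 1 1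
  have f1 : m * pd eX T p = 0 := by rw [hm]; linear_combination k1
  have f2 : n * pd eX T p = 0 := by rw [hn]; linear_combination k2 - k1
  have f3 : l * pd eX T p + m * pd eU T p = 0 := by rw [hl, hm]; linear_combination (k3 - k4) / 2
  have f4 : l * pd eU T p = 0 := by rw [hl]; linear_combination (k3 + k4) / 2 - k1
  have f5 : n * pd eU T p = 0 := by rw [hn]; linear_combination k5 - k3 - (k2 - k1)
  have hu : pd eU T p = 0 := by
    have : (pd eU U p * m - pd eX U p * l - pd eT U p * n) * pd eU T p ^ 2 = 0 := by
      linear_combination (pd eU U p * pd eU T p) * f3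
        - (pd eU U p * pd eX T p) * f4 - pd eX U p * pd eU T p * f4
        - pd eT U p * pd eU T p * f5
    exact pow_eq_zero_iff (two_ne_zero) |>.1 ((mul_eq_zero.1 this).resolve_left hdet)
  have hx : pd eX T p = 0 := by
    rw [hu, mul_zero, add_zero] at f3
    have : (pd eU U p * m - pd eX U p * l - pd eT U p * n) * pd eX T p = 0 := by
      linear_combination pd eU U p * f1 - pd eX U p * f3 - pd eT U p * f2
    exact (mul_eq_zero.1 this).resolve_left hdet
  exact ⟨hx, hu⟩

theorem fderiv_fderiv_apply_self (hΩ : IsOpen Ω) {F : Pt → ℝ} (hF : ContDiffOn ℝ ∞ F Ω) {p : Pt}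
    (hp : p ∈ Ω) (y z : ℝ) :
    fderiv ℝ (fderiv ℝ F) p (0, y, z) (0, y, z) = y ^ 2 * pd eX (pd eX F) p
      + 2 * y * z * pd eX (pd eU F) p + z ^ 2 * pd eU (pd eU F) p := by
  have hv : ((0, y, z) : Pt) = y • eX + z • eU := by simp [eX, eU]
  have hc := pd_comm hΩ hF hp eU eX
  rw [hv]
  simp only [map_add, map_smul, add_apply, smul_apply, fderiv_fderiv_apply hΩ hF hp, smul_eq_mul,
    hc]
  ring

/-- The determining equation with the time component independent of `x` and `u`. -/
theorem reduced_prolongation (h : IsAdmissible c d Ω fun p => (T p, X p, U p)) {p : Pt}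
    (hp : p ∈ Ω) (a b gX : ℝ) (hb : pd eX X p + b * pd eU X p ≠ 0)
    (hgX : gX * (pd eX X p + b * pd eU X p) = pd eX U p + b * pd eU U p) :
    (pd eX X p + b * pd eU X p) ^ 2 * (pd eT U p + a * pd eU U p
        - gX * (pd eT X p + a * pd eU X p) + pd eT T p * d.toFun (T p) * U p ^ 3)
      = pd eT T p * (pd eX (pd eX U) p + 2 * b * pd eX (pd eU U) p + b ^ 2 * pd eU (pd eU U) p
          + (a + c.toFun p.1 * p.2.2 ^ 3) * pd eU U p
        - gX * (pd eX (pd eX X) p + 2 * b * pd eX (pd eU X) p + b ^ 2 * pd eU (pd eU X) p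
          + (a + c.toFun p.1 * p.2.2 ^ 3) * pd eU X p)) := by
  have hΦ := h.pointTransformation
  have hΩ := hΦ.isOpen
  obtain ⟨hTs, hXs, hUs⟩ := hΦ.contDiffOn_components
  obtain ⟨hx, hu⟩ := pd_time_eq_zero h hp
  have ht : pd eT T p ≠ 0 := by
    intro h0
    apply jacobian_ne_zero hΦ hp
    rw [hx, hu, h0]
    ring
  obtain ⟨gT, hgT⟩ : ∃ gT, gT * pd eT T p
      = pd eT U p + a * pd eU U p - gX * (pd eT X p + a * pd eU X p) :=
    ⟨_, div_mul_cancel₀ _ ht⟩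
  -- With `T_x = T_u = 0` the coefficient of `q` in `κ` vanishes, so `q = 0` loses nothing, and `w`
  -- has no time component.
  have hpro := h.mapsEquation.prolongation hΦ hp a b 0 gT gX
    (by rw [hx, hu]; simpa using ⟨ht, hb⟩)
    (by rw [hu]; linear_combination hgT)
    (by rw [hx, hu]; linear_combination hgX)
    (w := (0, pd eT T p, pd eT T p * b)) (by rw [hx, hu]; simp)
    (κ := (a + c.toFun p.1 * p.2.2 ^ 3) * pd eT T p ^ 2) (by rw [hx, hu]; ring)
  rw [fderiv_fderiv_apply_self hΩ hTs hp, fderiv_fderiv_apply_self hΩ hXs hp,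
    fderiv_fderiv_apply_self hΩ hUs hp, fderiv_apply_eq_pd,
    pd_eq_zero_of_eqOn_const hΩ (fun q hq => (pd_time_eq_zero h hq).1) hp,
    pd_eq_zero_of_eqOn_const hΩ (fun q hq => (pd_time_eq_zero h hq).2) hp,
    pd_eq_zero_of_eqOn_const hΩ (fun q hq => (pd_time_eq_zero h hq).2) hp, hu] at hpro
  apply mul_left_cancel₀ ht
  linear_combination hpro - pd eT T p * (pd eX X p + b * pd eU X p) ^ 2 * hgT

theorem pd_space_eq (h : IsAdmissible c d Ω fun p => (T p, X p, U p)) {p : Pt} (hp : p ∈ Ω) :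
    pd eU X p = 0 ∧ pd eX X p ^ 2 = pd eT T p ∧ pd eX X p ≠ 0 ∧ pd eU U p ≠ 0 := by
  have hdet := jacobian_ne_zero h.pointTransformation hp
  obtain ⟨hx, hu⟩ := pd_time_eq_zero h hp
  rw [hx, hu] at hdet
  have key : ∀ b : ℝ, (pd eX X p + b * pd eU X p)
      * ((pd eX X p + b * pd eU X p) ^ 2 - pd eT T p) = 0 := by
    intro b
    by_contra hne
    have hb := left_ne_zero_of_mul hne
    obtain ⟨gX, hgX⟩ : ∃ gX, gX * (pd eX X p + b * pd eU X p) = pd eX U p + b * pd eU U p :=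
      ⟨_, div_mul_cancel₀ _ hb⟩
    have h0 := reduced_prolongation h hp 0 b gX hb hgX
    have h1 := reduced_prolongation h hp 1 b gX hb hgX
    -- The coefficient of `a`. Its second factor, multiplied by `T_t (X_x + b X_u)`, is the Jacobian
    -- determinant.
    have h2 : ((pd eX X p + b * pd eU X p) ^ 2 - pd eT T p)
        * (pd eU U p - gX * pd eU X p) = 0 := by
      linear_combination h1 - h0
    have hK := (mul_eq_zero.1 h2).resolve_left (right_ne_zero_of_mul hne)
    apply hdet
    linear_combination pd eT T p * ((pd eX X p + b * pd eU X p) * hK + pd eU X p * hgX)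
  have hXu : pd eU X p = 0 := by
    -- `key` is a cubic in `b`; its third difference is six times the leading coefficient.
    have : pd eU X p ^ 3 = 0 := by
      linear_combination (key 2 - 3 * key 1 + 3 * key 0 - key (-1)) / 6
    exact pow_eq_zero_iff (three_ne_zero) |>.1 this
  have hXx : pd eX X p ≠ 0 := by
    intro h0
    apply hdet
    rw [h0, hXu]
    ring
  refine ⟨hXu, ?_, hXx, ?_⟩
  · have := key 0
    rw [zero_mul, add_zero] at this
    linear_combination (mul_eq_zero.1 this).resolve_left hXx
  · intro h0
    apply hdet
    rw [h0, hXu]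
    ring

theorem pd_time_ne_zero (h : IsAdmissible c d Ω fun p => (T p, X p, U p)) {p : Pt} (hp : p ∈ Ω) :
    pd eT T p ≠ 0 := by
  rw [← (pd_space_eq h hp).2.1]
  exact pow_ne_zero 2 (pd_space_eq h hp).2.2.1

theorem determining_equations (h : IsAdmissible c d Ω fun p => (T p, X p, U p)) {p : Pt}
    (hp : p ∈ Ω) :
    pd eU (pd eU U) p = 0 ∧
    2 * pd eX X p * pd eX (pd eU U) p = -(pd eU U p * pd eT X p) ∧
    pd eX X p * pd eT U p - pd eX U p * pd eT X p
        + pd eX X p * (pd eT T p * (d.toFun (T p) * U p ^ 3))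
      = pd eX X p * (pd eX (pd eX U) p + c.toFun p.1 * (p.2.2 ^ 3 * pd eU U p)) := by
  have hΦ := h.pointTransformation
  have hΩ := hΦ.isOpen
  obtain ⟨hTs, hXs, hUs⟩ := hΦ.contDiffOn_components
  obtain ⟨hXu, hXT, hXx, -⟩ := pd_space_eq h hp
  have ht := pd_time_ne_zero h hp
  have hXXu : ∀ v, pd v (pd eU X) p = 0 := fun v =>
    pd_eq_zero_of_eqOn_const hΩ (fun q hq => (pd_space_eq h hq).1) hp v
  -- Differentiate `X_x² = T_t` in `x`, where the right side is constant.
  have hXXX : pd eX (pd eX X) p = 0 := by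
    have h1 := lineDeriv_unique hΩ (fun q hq => (pd_space_eq h hq).2.1) hp
      (lineDeriv_pow 2 (hasLineDerivAt_pd hΩ (contDiffOn_pd hΩ hXs eX) hp eX))
      (hasLineDerivAt_pd hΩ (contDiffOn_pd hΩ hTs eT) hp eX)
    rw [pd_comm hΩ hTs hp, pd_eq_zero_of_eqOn_const hΩ (fun q hq => (pd_time_eq_zero h hq).1) hp]
      at h1
    simpa [hXx] using h1
  -- Because `X_x² = T_t`, the terms in `a` now cancel, so `a = 0` suffices; the three values of `b`
  -- below separate the coefficients of a quadratic.
  have key : ∀ b : ℝ, pd eX X p * pd eT U p - (pd eX U p + b * pd eU U p) * pd eT X p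
        + pd eX X p * (pd eT T p * (d.toFun (T p) * U p ^ 3))
      = pd eX X p * (pd eX (pd eX U) p + 2 * b * pd eX (pd eU U) p + b ^ 2 * pd eU (pd eU U) p
        + c.toFun p.1 * (p.2.2 ^ 3 * pd eU U p)) := by
    intro b
    have hgX : (pd eX U p + b * pd eU U p) / pd eX X p * pd eX X p = pd eX U p + b * pd eU U p :=
      div_mul_cancel₀ _ hXx
    set gX := (pd eX U p + b * pd eU U p) / pd eX X p
    have := reduced_prolongation h hp 0 b gX (by rwa [hXu, mul_zero, add_zero])
      (by rw [hXu]; linear_combination hgX)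
    rw [hXu, hXXu, hXXu, hXXX, mul_zero, add_zero, hXT] at this
    apply mul_left_cancel₀ ht
    linear_combination pd eX X p * this + pd eT T p * pd eT X p * hgX
  have k0 := key 0
  have k1 := key 1
  have k2 := key (-1)
  refine ⟨?_, ?_, ?_⟩
  · apply mul_left_cancel₀ hXx
    linear_combination k0 - (k1 + k2) / 2
  · linear_combination (k2 - k1) / 2
  · linear_combination k0

/-- The nonlinearity does the work: comparing the cubic terms in `u` links `c` and `d`, and since
they depend on time only, no dependence on `x`, shift of `u` or Galilean-type term survives. -/
theorem affine_of_isAdmissible (h : IsAdmissible c d Ω fun p => (T p, X p, U p)) :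
    (∀ p ∈ Ω, pd eT T p * (d.toFun (T p) * pd eU U p ^ 2) = c.toFun p.1) ∧
    (∀ p ∈ Ω, U p = pd eU U p * p.2.2) ∧
    (∀ p ∈ Ω, pd eX (pd eU U) p = 0) ∧ (∀ p ∈ Ω, pd eT X p = 0) ∧
    (∀ p ∈ Ω, pd eT (pd eT T) p = 0) ∧ ∀ p ∈ Ω, pd eT (pd eU U) p = 0 := by
  have hΦ := h.pointTransformation
  have hΩ := hΦ.isOpen
  obtain ⟨hTs, hXs, hUs⟩ := hΦ.contDiffOn_components
  have smooth : ∀ {F : Pt → ℝ} (v : Pt), ContDiffOn ℝ ∞ F Ω → ContDiffOn ℝ ∞ (pd v F) Ω :=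
    fun v hF => contDiffOn_pd hΩ hF v
  have line : ∀ {F : Pt → ℝ}, ContDiffOn ℝ ∞ F Ω → ∀ {p}, p ∈ Ω → ∀ v {k : ℝ}, pd v F p = k →
      HasLineDerivAt ℝ F k p v := fun hF p hp v k hk => hk ▸ hasLineDerivAt_pd hΩ hF hp v
  have comm : ∀ {F : Pt → ℝ}, ContDiffOn ℝ ∞ F Ω → ∀ {p}, p ∈ Ω → ∀ v w {k : ℝ},
      (∀ q ∈ Ω, pd v F q = k) → pd v (pd w F) p = 0 := fun hF p hp v w k hk => by
    rw [pd_comm hΩ hF hp]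
    exact pd_eq_zero_of_eqOn_const hΩ hk hp w
  have hTx : ∀ p ∈ Ω, pd eX T p = 0 := fun p hp => (pd_time_eq_zero h hp).1
  have hTu : ∀ p ∈ Ω, pd eU T p = 0 := fun p hp => (pd_time_eq_zero h hp).2
  have hTt : ∀ p ∈ Ω, pd eT T p ≠ 0 := fun p hp => pd_time_ne_zero h hp
  have hXu : ∀ p ∈ Ω, pd eU X p = 0 := fun p hp => (pd_space_eq h hp).1
  have hXx : ∀ p ∈ Ω, pd eX X p ≠ 0 := fun p hp => (pd_space_eq h hp).2.2.1
  have hUu : ∀ p ∈ Ω, pd eU U p ≠ 0 := fun p hp => (pd_space_eq h hp).2.2.2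
  have hUuu : ∀ p ∈ Ω, pd eU (pd eU U) p = 0 := fun p hp => (determining_equations h hp).1
  have hA := smooth eU hUs
  have hD : ∀ p ∈ Ω, ∀ v, pd v T p = 0 → HasLineDerivAt ℝ (fun q => d.toFun (T q)) 0 p v := by
    intro p hp v hv
    have hdT : T p ∈ d.dom := h.mapsEquation.target p hp
    have := lineDeriv_comp (((d.smooth.contDiffAt (d.isOpen_dom.mem_nhds hdT))).differentiableAt
      (by simp)) (line hTs hp v hv)
    rwa [mul_zero] at this
  have hC : ∀ p ∈ Ω, ∀ v : Pt, v.1 = 0 → HasLineDerivAt ℝ (fun q : Pt => c.toFun q.1) 0 p v := by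
    intro p hp v hv
    have := lineDeriv_comp (F := fun q : Pt => q.1) (((c.smooth.contDiffAt
      (c.isOpen_dom.mem_nhds (h.mapsEquation.source p hp)))).differentiableAt (by simp))
      (lineDeriv_fst p v)
    rwa [hv, mul_zero] at this
  have hu1 : ∀ p : Pt, HasLineDerivAt ℝ (fun q : Pt => q.2.2) 1 p eU :=
    fun p => lineDeriv_snd_snd p eU
  have E0 := fun p hp => (determining_equations h (p := p) hp).2.2
  have hXtu : ∀ p ∈ Ω, HasLineDerivAt ℝ (pd eT X) 0 p eU := fun p hp =>
    line (smooth eT hXs) hp eU (comm hXs hp eU eT hXu)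
  have hXxu : ∀ p ∈ Ω, HasLineDerivAt ℝ (pd eX X) 0 p eU := fun p hp =>
    line (smooth eX hXs) hp eU (comm hXs hp eU eX hXu)
  have hTtu : ∀ p ∈ Ω, HasLineDerivAt ℝ (pd eT T) 0 p eU := fun p hp =>
    line (smooth eT hTs) hp eU (comm hTs hp eU eT hTu)
  have hTtx : ∀ p ∈ Ω, HasLineDerivAt ℝ (pd eT T) 0 p eX := fun p hp =>
    line (smooth eT hTs) hp eX (comm hTs hp eX eT hTx)
  have hAu : ∀ p ∈ Ω, HasLineDerivAt ℝ (pd eU U) 0 p eU := fun p hp => line hA hp eU (hUuu p hp)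
  have hUxxu : ∀ p ∈ Ω, pd eU (pd eX (pd eX U)) p = pd eX (pd eX (pd eU U)) p := fun p hp => by
    rw [pd_comm hΩ (smooth eX hUs) hp]
    exact pd_congr hΩ (fun q hq => pd_comm hΩ hUs hq eU eX) hp eX
  have hAxxu : ∀ p ∈ Ω, pd eU (pd eX (pd eX (pd eU U))) p = 0 := fun p hp => by
    rw [pd_comm hΩ (smooth eX hA) hp]
    exact pd_eq_zero_of_eqOn_const hΩ (fun q hq => comm hA hq eU eX hUuu) hp eX
  have E1 : ∀ p ∈ Ω, pd eX X p * pd eT (pd eU U) p - pd eX (pd eU U) p * pd eT X p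
      + 3 * (pd eX X p * (pd eT T p * (d.toFun (T p) * (U p ^ 2 * pd eU U p))))
      = pd eX X p * (pd eX (pd eX (pd eU U)) p
        + 3 * (c.toFun p.1 * (p.2.2 ^ 2 * pd eU U p))) := by
    intro p hp
    have := lineDeriv_unique hΩ E0 hp
      (lineDeriv_add (lineDeriv_sub
        (lineDeriv_mul (hXxu p hp) (line (smooth eT hUs) hp eU (pd_comm hΩ hUs hp eU eT)))
        (lineDeriv_mul (line (smooth eX hUs) hp eU (pd_comm hΩ hUs hp eU eX)) (hXtu p hp)))
        (lineDeriv_mul (hXxu p hp) (lineDeriv_mul (hTtu p hp) (lineDeriv_mul (hD p hp eU (hTu p hp))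
          (lineDeriv_pow 3 (line hUs hp eU rfl))))))
      (lineDeriv_mul (hXxu p hp) (lineDeriv_add
        (line (smooth eX (smooth eX hUs)) hp eU (hUxxu p hp))
        (lineDeriv_mul (hC p hp eU rfl) (lineDeriv_mul (lineDeriv_pow 3 (hu1 p)) (hAu p hp)))))
    norm_num at this
    linear_combination this
  -- A second `u`-derivative removes everything but the nonlinear terms, since `U_u` does not depend
  -- on `u`.
  have E2 : ∀ p ∈ Ω, pd eT T p * (d.toFun (T p) * (U p * pd eU U p)) = c.toFun p.1 * p.2.2 := by
    intro p hp
    have three : ∀ {F : Pt → ℝ} {k : ℝ}, HasLineDerivAt ℝ F k p eU →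
        HasLineDerivAt ℝ (fun q => 3 * F q) (3 * k) p eU := fun hF => HasDerivAt.const_mul 3 hF
    have := lineDeriv_unique hΩ E1 hp
      (lineDeriv_add (lineDeriv_sub
        (lineDeriv_mul (hXxu p hp) (line (smooth eT hA) hp eU (comm hA hp eU eT hUuu)))
        (lineDeriv_mul (line (smooth eX hA) hp eU (comm hA hp eU eX hUuu)) (hXtu p hp)))
        (three (lineDeriv_mul (hXxu p hp) (lineDeriv_mul (hTtu p hp)
          (lineDeriv_mul (hD p hp eU (hTu p hp))
            (lineDeriv_mul (lineDeriv_pow 2 (line hUs hp eU rfl)) (hAu p hp)))))))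
      (lineDeriv_mul (hXxu p hp) (lineDeriv_add
        (line (smooth eX (smooth eX hA)) hp eU (hAxxu p hp))
        (three (lineDeriv_mul (hC p hp eU rfl)
          (lineDeriv_mul (lineDeriv_pow 2 (hu1 p)) (hAu p hp))))))
    norm_num at this
    apply mul_left_cancel₀ (mul_ne_zero (hXx p hp) (hUu p hp))
    linear_combination this / 6
  have E3 : ∀ p ∈ Ω, pd eT T p * (d.toFun (T p) * pd eU U p ^ 2) = c.toFun p.1 := by
    intro p hp
    have := lineDeriv_unique hΩ E2 hp
      (lineDeriv_mul (hTtu p hp) (lineDeriv_mul (hD p hp eU (hTu p hp))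
        (lineDeriv_mul (line hUs hp eU rfl) (hAu p hp))))
      (lineDeriv_mul (hC p hp eU rfl) (hu1 p))
    linear_combination this
  have hd0 : ∀ p ∈ Ω, pd eT T p * (d.toFun (T p) * pd eU U p) ≠ 0 := fun p hp =>
    mul_ne_zero (hTt p hp) (mul_ne_zero (d.ne_zero _ (h.mapsEquation.target p hp)) (hUu p hp))
  have hU : ∀ p ∈ Ω, U p = pd eU U p * p.2.2 := by
    intro p hp
    apply mul_left_cancel₀ (hd0 p hp)
    -- Subtracting `u` times `E3` from `E2` leaves `T_t d(T) U_u (U - u U_u) = 0`.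
    linear_combination E2 p hp - p.2.2 * E3 p hp
  -- In `E3` every factor except `U_u²` is independent of `x`.
  have hAx : ∀ p ∈ Ω, pd eX (pd eU U) p = 0 := by
    intro p hp
    have := lineDeriv_unique hΩ E3 hp
      (lineDeriv_mul (hTtx p hp) (lineDeriv_mul (hD p hp eX (hTx p hp))
        (lineDeriv_pow 2 (line hA hp eX rfl)))) (hC p hp eX rfl)
    norm_num at this
    apply mul_left_cancel₀ (hd0 p hp)
    have h2 : pd eT T p * (d.toFun (T p) * (2 * pd eU U p * pd eX (pd eU U) p)) = 0 := by
      simpa using this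
    linear_combination h2 / 2
  have hXt : ∀ p ∈ Ω, pd eT X p = 0 := by
    intro p hp
    have := (determining_equations h hp).2.1
    rw [hAx p hp] at this
    apply mul_left_cancel₀ (hUu p hp)
    linear_combination this
  have hTtt : ∀ p ∈ Ω, pd eT (pd eT T) p = 0 := by
    intro p hp
    have := lineDeriv_unique hΩ (fun q hq => (pd_space_eq h hq).2.1) hp
      (lineDeriv_pow 2 (line (smooth eX hXs) hp eT
        ((pd_comm hΩ hXs hp eT eX).trans (pd_eq_zero_of_eqOn_const hΩ hXt hp eX))))
      (line (smooth eT hTs) hp eT rfl)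
    linear_combination -this
  have hUx : ∀ p ∈ Ω, pd eX U p = 0 := by
    intro p hp
    have := lineDeriv_unique hΩ hU hp (line hUs hp eX rfl)
      (lineDeriv_mul (line hA hp eX (hAx p hp)) (lineDeriv_snd_snd p eX))
    rw [this]
    simp [eX]
  -- In the last determining equation the cubic terms cancel by `E3` and the `x`-derivatives of `U`
  -- vanish, leaving `X_x U_t = 0`.
  have hUt : ∀ p ∈ Ω, pd eT U p = 0 := by
    intro p hp
    have h0 := E0 p hp
    rw [hUx p hp, pd_eq_zero_of_eqOn_const hΩ hUx hp] at h0
    apply mul_left_cancel₀ (hXx p hp)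
    have hUp := hU p hp
    rw [hUp] at h0
    linear_combination h0 - pd eX X p * pd eU U p * p.2.2 ^ 3 * E3 p hp
  refine ⟨E3, hU, hAx, hXt, hTtt, fun p hp => ?_⟩
  rw [pd_comm hΩ hUs hp]
  exact pd_eq_zero_of_eqOn_const hΩ hUt hp eU

theorem exists_scaling_of_components (h : IsAdmissible c d Ω fun p => (T p, X p, U p)) :
    ∃ δ₀ δ₁ δ₂ δ₃ : ℝ, δ₁ * δ₃ ≠ 0 ∧ ∀ p ∈ Ω, (T p, X p, U p) = scaling δ₀ δ₁ δ₂ δ₃ p ∧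
      d.toFun (δ₁ ^ 2 * p.1 + δ₀) = 1 / (δ₁ ^ 2 * δ₃ ^ 2) * c.toFun p.1 := by
  have hΦ := h.pointTransformation
  have hΩ := hΦ.isOpen
  obtain ⟨hTs, hXs, hUs⟩ := hΦ.contDiffOn_components
  obtain ⟨hcd, hU, hAx, hXt, hTtt, hAt⟩ := affine_of_isAdmissible h
  obtain ⟨δ₃, h3⟩ := exists_eq_const_of_pd_eq_zero hΩ h.connected (contDiffOn_pd hΩ hUs eU) hAt hAx
    fun p hp => (determining_equations h hp).1
  obtain ⟨α, hα⟩ := exists_eq_const_of_pd_eq_zero hΩ h.connected (contDiffOn_pd hΩ hTs eT) hTtt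
    (fun p hp => by
      rw [pd_comm hΩ hTs hp]
      exact pd_eq_zero_of_eqOn_const hΩ (fun q hq => (pd_time_eq_zero h hq).1) hp eT)
    (fun p hp => by
      rw [pd_comm hΩ hTs hp]
      exact pd_eq_zero_of_eqOn_const hΩ (fun q hq => (pd_time_eq_zero h hq).2) hp eT)
  -- `X_x` is nonzero and its square is the constant `α`.
  have hXxv : ∀ v, ∀ p ∈ Ω, pd v (pd eX X) p = 0 := by
    intro v p hp
    have h1 := lineDeriv_unique hΩ (G := fun _ => α)
      (fun q hq => (pd_space_eq h hq).2.1.trans (hα q hq)) hp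
      (lineDeriv_pow 2 (hasLineDerivAt_pd hΩ (contDiffOn_pd hΩ hXs eX) hp v))
      (hasDerivAt_const (0 : ℝ) α)
    simpa [(pd_space_eq h hp).2.2.1] using h1
  obtain ⟨δ₁, h1⟩ := exists_eq_const_of_pd_eq_zero hΩ h.connected (contDiffOn_pd hΩ hXs eX)
    (hXxv eT) (hXxv eX) (hXxv eU)
  obtain ⟨δ₀, hT⟩ := exists_eq_affine_of_pd_const hΩ h.connected hTs hα
    (fun p hp => (pd_time_eq_zero h hp).1) (fun p hp => (pd_time_eq_zero h hp).2)
  obtain ⟨δ₂, hX⟩ := exists_eq_affine_of_pd_const hΩ h.connected hXs hXt h1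
    (fun p hp => (pd_space_eq h hp).1)
  obtain ⟨p₀, hp₀⟩ := h.connected.nonempty
  obtain ⟨-, e1, e2, e3⟩ := pd_space_eq h hp₀
  rw [h1 p₀ hp₀, hα p₀ hp₀] at e1
  rw [h1 p₀ hp₀] at e2
  rw [h3 p₀ hp₀] at e3
  refine ⟨δ₀, δ₁, δ₂, δ₃, mul_ne_zero e2 e3, fun p hp => ?_⟩
  have hTp : T p = δ₁ ^ 2 * p.1 + δ₀ := by rw [hT p hp, e1]; ring
  constructor
  · rw [hTp, hX p hp, hU p hp, h3 p hp, scaling]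
    simp
  · rw [← hcd p hp, hα p hp, h3 p hp, ← hTp, ← e1]
    field_simp

end Determining

/-! ### The equivalence group and the equivalence groupoid -/

theorem exists_scaling_of_isAdmissible {c d : Coeff} {Ω : Set Pt} {Φ : Pt → Pt}
    (h : IsAdmissible c d Ω Φ) :
    ∃ δ₀ δ₁ δ₂ δ₃ : ℝ, δ₁ * δ₃ ≠ 0 ∧ ∀ p ∈ Ω, Φ p = scaling δ₀ δ₁ δ₂ δ₃ p ∧
      d.toFun (δ₁ ^ 2 * p.1 + δ₀) = 1 / (δ₁ ^ 2 * δ₃ ^ 2) * c.toFun p.1 :=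
  exists_scaling_of_components (T := fun p => (Φ p).1) (X := fun p => (Φ p).2.1)
    (U := fun p => (Φ p).2.2) h

/-- A scaling is determined by its values on a nonempty open set. -/
theorem scaling_factors_unique {Ω : Set Pt} (hΩ : IsOpen Ω) (hne : Ω.Nonempty)
    {δ₀ δ₁ δ₂ δ₃ ε₀ ε₁ ε₂ ε₃ : ℝ}
    (h : ∀ p ∈ Ω, scaling δ₀ δ₁ δ₂ δ₃ p = scaling ε₀ ε₁ ε₂ ε₃ p) : δ₁ = ε₁ ∧ δ₃ = ε₃ := by
  obtain ⟨p, hp⟩ := hne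
  -- A small diagonal displacement stays in `Ω` and compares the slopes in `x` and `u` at once.
  have hlim : Tendsto (fun s : ℝ => p + s • ((1, 1, 1) : Pt)) (𝓝[≠] 0) (𝓝 p) := by
    have : Continuous (fun s : ℝ => p + s • ((1, 1, 1) : Pt)) := by fun_prop
    have h0 := this.tendsto 0
    rw [zero_smul, add_zero] at h0
    exact h0.mono_left nhdsWithin_le_nhds
  obtain ⟨s, hs, hs0⟩ := ((hlim.eventually_mem (hΩ.mem_nhds hp)).and
    (eventually_mem_nhdsWithin (a := (0 : ℝ)) (s := {0}ᶜ))).exists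
  have hs0 : s ≠ 0 := hs0
  have e1 := h p hp
  have e2 := h _ hs
  simp only [scaling, Prod.mk.injEq, Prod.fst_add, Prod.snd_add, Prod.smul_mk, smul_eq_mul,
    mul_one] at e1 e2
  constructor
  · apply mul_right_cancel₀ hs0
    linear_combination e2.2.1 - e1.2.1
  · apply mul_right_cancel₀ hs0
    linear_combination e2.2.2 - e1.2.2

/-- The equation with a constant coefficient. -/
def Coeff.const {k : ℝ} (hk : k ≠ 0) : Coeff where
  dom := univ
  isOpen_dom := isOpen_univ
  nonempty_dom := univ_nonempty
  ordConnected_dom := ordConnected_univ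
  toFun _ := k
  smooth := contDiffOn_const
  ne_zero _ _ := hk

theorem exists_scaling_of_isEquivalenceTransformation {Ω : Set Pt} {Ψ : Pt × ℝ → Pt × ℝ}
    (h : IsEquivalenceTransformation Ω Ψ) :
    ∃ δ₀ δ₁ δ₂ δ₃ : ℝ, δ₁ * δ₃ ≠ 0 ∧ ∀ p ∈ Ω, ∀ k : ℝ, k ≠ 0 →
      Ψ (p, k) = (scaling δ₀ δ₁ δ₂ δ₃ p, 1 / (δ₁ ^ 2 * δ₃ ^ 2) * k) := by
  obtain ⟨hconn, -, Φ, hΦ, hΨ, hmap⟩ := h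
  have key : ∀ k : ℝ, k ≠ 0 → ∃ δ₀ δ₁ δ₂ δ₃ : ℝ, δ₁ * δ₃ ≠ 0 ∧ ∀ p ∈ Ω,
      Φ p = scaling δ₀ δ₁ δ₂ δ₃ p ∧ (Ψ (p, k)).2 = 1 / (δ₁ ^ 2 * δ₃ ^ 2) * k := by
    intro k hk
    -- A constant coefficient realizes the value `k` at every point, and its domain does not shrink
    -- `Ω`.
    obtain ⟨d, hd, hd'⟩ := hmap (Coeff.const hk)
    have hΩ' : Ω ∩ {p | p.1 ∈ (Coeff.const hk).dom} = Ω :=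
      inter_eq_left.2 fun p _ => mem_univ p.1
    rw [hΩ'] at hd
    obtain ⟨δ₀, δ₁, δ₂, δ₃, hδ, hs⟩ := exists_scaling_of_isAdmissible ⟨hconn, hΦ, hd⟩
    refine ⟨δ₀, δ₁, δ₂, δ₃, hδ, fun p hp => ⟨(hs p hp).1, ?_⟩⟩
    have h2 := hd' p hp (mem_univ p.1)
    rw [(hs p hp).1] at h2
    exact h2.symm.trans (hs p hp).2
  obtain ⟨δ₀, δ₁, δ₂, δ₃, hδ, hs⟩ := key 1 one_ne_zero
  refine ⟨δ₀, δ₁, δ₂, δ₃, hδ, fun p hp k hk => ?_⟩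
  obtain ⟨ε₀, ε₁, ε₂, ε₃, -, hs'⟩ := key k hk
  -- The constants obtained for `k` might depend on `k`, but they describe the same `Φ`.
  obtain ⟨e1, e3⟩ := scaling_factors_unique hΦ.isOpen hconn.nonempty
    fun q hq => (hs q hq).1.symm.trans (hs' q hq).1
  refine Prod.ext ((hΨ p hp k hk).trans (hs p hp).1) ?_
  rw [(hs' p hp).2, e1, e3]

theorem mem_equivalenceGroup_iff {σ : Equiv.Perm (Pt × ℝˣ)} :
    σ ∈ equivalenceGroup ↔ ∃ δ₀ δ₁ δ₂ δ₃ : ℝ, IsScaling σ δ₀ δ₁ δ₂ δ₃ := by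
  constructor
  · rintro ⟨Ψ, hΨ, hσ⟩
    obtain ⟨δ₀, δ₁, δ₂, δ₃, hδ, h⟩ := exists_scaling_of_isEquivalenceTransformation hΨ
    refine ⟨δ₀, δ₁, δ₂, δ₃, hδ, fun p k => ?_⟩
    have := (hσ p k).symm.trans (h p (mem_univ p) k k.ne_zero)
    exact Prod.mk.inj this
  · rintro ⟨δ₀, δ₁, δ₂, δ₃, h⟩
    exact h.mem_equivalenceGroup

/-- The usual equivalence group, as a subgroup of the group of permutations. -/
def equivalenceSubgroup : Subgroup (Equiv.Perm (Pt × ℝˣ)) where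
  carrier := equivalenceGroup
  one_mem' := IsScaling.one.mem_equivalenceGroup
  mul_mem' ha hb := by
    obtain ⟨_, _, _, _, ha⟩ := mem_equivalenceGroup_iff.1 ha
    obtain ⟨_, _, _, _, hb⟩ := mem_equivalenceGroup_iff.1 hb
    exact (ha.mul hb).mem_equivalenceGroup
  inv_mem' ha := by
    obtain ⟨_, _, _, _, ha⟩ := mem_equivalenceGroup_iff.1 ha
    exact ha.inv.mem_equivalenceGroup

/-- By `hc` the value of `c` at each point is a unit, so the condition defining `IsInducedBy` is
nowhere vacuous. -/
theorem isInducedBy_iff_of_isScaling {σ : Equiv.Perm (Pt × ℝˣ)} {δ₀ δ₁ δ₂ δ₃ : ℝ}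
    (hσ : IsScaling σ δ₀ δ₁ δ₂ δ₃) {c d : Coeff} {Ω : Set Pt} {Φ : Pt → Pt}
    (hc : ∀ p ∈ Ω, p.1 ∈ c.dom) :
    IsInducedBy σ c d Ω Φ ↔ ∀ p ∈ Ω, Φ p = scaling δ₀ δ₁ δ₂ δ₃ p ∧
      d.toFun (δ₁ ^ 2 * p.1 + δ₀) = 1 / (δ₁ ^ 2 * δ₃ ^ 2) * c.toFun p.1 := by
  constructor
  · intro h p hp
    obtain ⟨h1, h2⟩ := h p hp (Units.mk0 _ (c.ne_zero _ (hc p hp))) rfl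
    rw [(hσ.2 p _).1] at h1
    rw [(hσ.2 p _).2, ← h1] at h2
    exact ⟨h1.symm, h2.symm⟩
  · intro h p hp k hk
    obtain ⟨h1, h2⟩ := h p hp
    rw [(hσ.2 p k).1, (hσ.2 p k).2, h1, hk, ← h2]
    exact ⟨rfl, rfl⟩

theorem exists_isInducedBy_iff {c d : Coeff} {Ω : Set Pt} {Φ : Pt → Pt}
    (hc : ∀ p ∈ Ω, p.1 ∈ c.dom) :
    (∃ σ ∈ equivalenceGroup, IsInducedBy σ c d Ω Φ) ↔
      ∃ δ₀ δ₁ δ₂ δ₃ : ℝ, δ₁ * δ₃ ≠ 0 ∧ ∀ p ∈ Ω, Φ p = scaling δ₀ δ₁ δ₂ δ₃ p ∧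
        d.toFun (δ₁ ^ 2 * p.1 + δ₀) = 1 / (δ₁ ^ 2 * δ₃ ^ 2) * c.toFun p.1 := by
  constructor
  · rintro ⟨σ, hσ, h⟩
    obtain ⟨δ₀, δ₁, δ₂, δ₃, hs⟩ := mem_equivalenceGroup_iff.1 hσ
    exact ⟨δ₀, δ₁, δ₂, δ₃, hs.1, (isInducedBy_iff_of_isScaling hs hc).1 h⟩
  · rintro ⟨δ₀, δ₁, δ₂, δ₃, hδ, h⟩
    obtain ⟨σ, hs⟩ := exists_isScaling δ₀ δ₂ hδ
    exact ⟨σ, hs.mem_equivalenceGroup, (isInducedBy_iff_of_isScaling hs hc).2 h⟩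

theorem isAdmissible_iff_scaling {c d : Coeff} {Ω : Set Pt} {Φ : Pt → Pt} (hΩ : IsOpen Ω)
    (hconn : IsConnected Ω) (hc : ∀ p ∈ Ω, p.1 ∈ c.dom) (hd : ∀ p ∈ Ω, (Φ p).1 ∈ d.dom) :
    IsAdmissible c d Ω Φ ↔
      ∃ δ₀ δ₁ δ₂ δ₃ : ℝ, δ₁ * δ₃ ≠ 0 ∧ ∀ p ∈ Ω, Φ p = scaling δ₀ δ₁ δ₂ δ₃ p ∧
        d.toFun (δ₁ ^ 2 * p.1 + δ₀) = 1 / (δ₁ ^ 2 * δ₃ ^ 2) * c.toFun p.1 := by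
  refine ⟨exists_scaling_of_isAdmissible, ?_⟩
  rintro ⟨δ₀, δ₁, δ₂, δ₃, hδ, h⟩
  have hs : ∀ p ∈ Ω, Φ p = scaling δ₀ δ₁ δ₂ δ₃ p := fun p hp => (h p hp).1
  exact ⟨hconn, isPointTransformation_of_eqOn_scaling hΩ hδ hs,
    mapsEquation_of_eqOn_scaling hΩ hc hd hδ hs fun p hp => (h p hp).2⟩

end NWS

theorem theorem3 :
    -- the class is normalized
    NWS.IsNormalized ∧
    -- the usual equivalence group is a group, and it consists of the listed transformations
    (∃ G : Subgroup (Equiv.Perm (NWS.Pt × ℝˣ)), (G : Set (Equiv.Perm (NWS.Pt × ℝˣ))) =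
      NWS.equivalenceGroup) ∧
    (∀ σ : Equiv.Perm (NWS.Pt × ℝˣ), σ ∈ NWS.equivalenceGroup ↔
      ∃ δ₀ δ₁ δ₂ δ₃ : ℝ, δ₁ * δ₃ ≠ 0 ∧ ∀ (p : NWS.Pt) (k : ℝˣ),
        (σ (p, k)).1 = NWS.scaling δ₀ δ₁ δ₂ δ₃ p ∧
        ((σ (p, k)).2 : ℝ) = 1 / (δ₁ ^ 2 * δ₃ ^ 2) * (k : ℝ)) ∧
    -- the same description of the equivalence transformations that are defined only locally
    (∀ (Ω : Set NWS.Pt) (Ψ : NWS.Pt × ℝ → NWS.Pt × ℝ), IsOpen Ω → IsConnected Ω →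
      (NWS.IsEquivalenceTransformation Ω Ψ ↔
        ∃ δ₀ δ₁ δ₂ δ₃ : ℝ, δ₁ * δ₃ ≠ 0 ∧ ∀ p ∈ Ω, ∀ k : ℝ, k ≠ 0 →
          Ψ (p, k) = (NWS.scaling δ₀ δ₁ δ₂ δ₃ p, 1 / (δ₁ ^ 2 * δ₃ ^ 2) * k))) ∧
    -- the equivalence groupoid consists of what the equivalence group induces
    (∀ (c d : NWS.Coeff) (Ω : Set NWS.Pt) (Φ : NWS.Pt → NWS.Pt), IsOpen Ω → IsConnected Ω →
      (∀ p ∈ Ω, p.1 ∈ c.dom) → (∀ p ∈ Ω, (Φ p).1 ∈ d.dom) →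
      (NWS.IsAdmissible c d Ω Φ ↔ ∃ σ ∈ NWS.equivalenceGroup, NWS.IsInducedBy σ c d Ω Φ) ∧
      (NWS.IsAdmissible c d Ω Φ ↔
        ∃ δ₀ δ₁ δ₂ δ₃ : ℝ, δ₁ * δ₃ ≠ 0 ∧ ∀ p ∈ Ω,
          Φ p = NWS.scaling δ₀ δ₁ δ₂ δ₃ p ∧
          d.toFun (δ₁ ^ 2 * p.1 + δ₀) = 1 / (δ₁ ^ 2 * δ₃ ^ 2) * c.toFun p.1)) := by
  refine ⟨fun c d Ω Φ h => ?_, ⟨NWS.equivalenceSubgroup, rfl⟩,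
    fun σ => NWS.mem_equivalenceGroup_iff, fun Ω Ψ hΩ hconn =>
      ⟨NWS.exists_scaling_of_isEquivalenceTransformation, ?_⟩,
    fun c d Ω Φ hΩ hconn hc hd => ⟨?_, NWS.isAdmissible_iff_scaling hΩ hconn hc hd⟩⟩
  · exact (NWS.exists_isInducedBy_iff h.mapsEquation.source).2
      (NWS.exists_scaling_of_isAdmissible h)
  · rintro ⟨δ₀, δ₁, δ₂, δ₃, hδ, h⟩
    exact NWS.isEquivalenceTransformation_of_scaling hΩ hconn hδ h
  · rw [NWS.isAdmissible_iff_scaling hΩ hconn hc hd, NWS.exists_isInducedBy_iff hc]
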